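/- Let $a_n\ge 0$ ($n\ge 0$) satisfy $\limsup_{n\to\infty}a_n^{1/n}<\infty$ and $a_0\neq 0$, and let $R\in(0,\infty]$ be defined by $R^{-1}=\limsup_{n\to\infty}a_n^{1/n}$. Let $\zeta_0,\zeta_1,\dots$ be independent standard complex Gaussian random variables (density $e^{-|z|^2}/\pi$ with respect to Lebesgue measure on $\mathbb C$), and let $F(z)=\sum_{n\ge 0}a_n\zeta_n z^n$ for $|z|<R$. Let $\mu$ be a finite measure on $(0,\infty)$ with $\inf\{r : \mu((r,\infty))=0\}=R$ and $\mu(\{R\})=0$, and let $p\in(0,\infty)$. For $s\in(0,R]$ and a function $f$ on $\{|z|<R\}$ write $$\|f\|_{A^p(\mu,s)}=\Bigl(\int_{(0,s)}\int_0^1|f(re^{2\pi i\theta})|^p\,d\theta\,d\mu(r)\Bigr)^{1/p},\qquad M_s(f)=\int_{(0,s)}\exp\Bigl(\int_0^1\log|f(re^{2\pi i\theta})|^p\,d\theta\Bigr)d\mu(r),$$ both with values in $[0,\infty]$, and $\|f\|_{A^p(\mu)}=\|f\|_{A^p(\mu,R)}$. Almost surely the series defining $F$ converges at every $z$ with $|z|<R$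 and $\theta\mapsto\log|F(re^{2\pi i\theta})|^p$ is integrable on $[0,1]$ for every $r\in(0,R)$. The following are equivalent: (i) $M_R(F)<\infty$ almost surely; (ii) $\mathbb E\bigl[\|F\|_{A^p(\mu)}^p\bigr]<\infty$; (iii) $\mathbb E[M_R(F)]<\infty$; (iv) $M_R(F)<\infty$ with positive probability. Moreover, for all $s\in(0,R]$, $$\mathbb E\Bigl[\frac{|F(0)|}{M_s(F)^{1/p}}\Bigr]\le\frac{\sqrt\pi\,\Gamma(1+p/2)^{1/p}\,a_0}{\bigl(\mathbb E\bigl[\|F\|_{A^p(\mu,s)}^p\bigr]\bigr)^{1/p}},$$ with the conventions $x/0=\infty$ for $x>0$ and $x/\infty=0$ for $0\le x<\infty$. -/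

import Mathlib

open MeasureTheory ProbabilityTheory Filter
open scoped ENNReal

namespace GaussianSeries

/-- The standard complex Gaussian law: density `exp (-|z|^2) / π` with respect to Lebesgue
measure on `ℂ`. -/
noncomputable def stdComplexGaussian : Measure ℂ :=
  volume.withDensity fun z => ENNReal.ofReal (Real.exp (-‖z‖ ^ 2) / Real.pi)

/-- `limsup a_n ^ (1 / n)`, as an extended nonnegative real. -/
noncomputable def rootLimsup (a : ℕ → ℝ) : ℝ≥0∞ :=
  limsup (fun n : ℕ => ENNReal.ofReal (a n ^ (1 / (n : ℝ)))) atTop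

/-- `r_μ = inf {r | μ (r, ∞) = 0}`, as an element of `[0, ∞]`. -/
noncomputable def outerRadius (μ : Measure ℝ) : ℝ≥0∞ :=
  sInf {r : ℝ≥0∞ | μ {x : ℝ | r < ENNReal.ofReal x} = 0}

/-- The interval `(0, s)`, where `s ∈ [0, ∞]`. -/
def radialInterval (s : ℝ≥0∞) : Set ℝ := {r : ℝ | 0 < r ∧ ENNReal.ofReal r < s}

/-- The point `r * exp (2 π i θ)`. -/
noncomputable def polarPoint (r θ : ℝ) : ℂ :=
  (r : ℂ) * Complex.exp (2 * Real.pi * Complex.I * θ)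

/-- The Gaussian series `z ↦ ∑ a_n ζ_n z^n` at a realization `w` of the coefficients `ζ`. -/
noncomputable def gaussianSeries (a : ℕ → ℝ) (w : ℕ → ℂ) (z : ℂ) : ℂ :=
  ∑' n : ℕ, (a n : ℂ) * w n * z ^ n

/-- `‖f‖_{A^p(μ, s)} = (∫_(0,s) ∫_0^1 |f (r e^{2πiθ})|^p dθ dμ(r)) ^ (1 / p)`,
with values in `[0, ∞]`. -/
noncomputable def bergmanNorm (μ : Measure ℝ) (p : ℝ) (s : ℝ≥0∞) (f : ℂ → ℂ) : ℝ≥0∞ :=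
  (∫⁻ r in radialInterval s, ∫⁻ θ in Set.Ioc (0 : ℝ) 1,
    ENNReal.ofReal (‖f (polarPoint r θ)‖ ^ p) ∂volume ∂μ) ^ (1 / p)

/-- The geometric-mean functional `∫_(0,s) exp (∫_0^1 log (|f (r e^{2πiθ})|^p) dθ) dμ(r)`,
with values in `[0, ∞]`. -/
noncomputable def geomMeanFunctional (μ : Measure ℝ) (p : ℝ) (s : ℝ≥0∞) (f : ℂ → ℂ) : ℝ≥0∞ :=
  ∫⁻ r in radialInterval s,
    ENNReal.ofReal (Real.exp (∫ θ in (0 : ℝ)..1, Real.log (‖f (polarPoint r θ)‖ ^ p))) ∂μ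

end GaussianSeries

namespace GaussianSeries

open scoped Topology RealInnerProductSpace

/-! Write K(r) = ∑ a_n² r^{2n}, Z = ∫_(0,s) K^{p/2} dμ, and let G(r) be the geometric mean of |F|^p
over the circle of radius r. At a fixed z with |z| = r, F(z) is a centred complex Gaussian of
variance K(r). Hence E‖F‖^p ≤ Γ(1+p/2) Z (`lintegral_bergmanNorm_rpow_le`), and everything rests on
the inverse estimate E[|F(0)|/|F(z)|] ≤ √π a_0 K(r)^{-1/2}
(`lintegral_enorm_zero_div_gaussianSeries_le`). The latter comes from rotating the Gaussian pair
formed by ζ_0 and the rest of the series until the denominator is a multiple of one coordinate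
(`lintegral_enorm_fst_div_le`).

Jensen gives G^{-1/p} ≤ ∫ |F|^{-1} dθ. Hölder gives Z^{(1+p)/p} ≤ (∫ G dμ)^{1/p} ∫ K^{(1+p)/2}
G^{-1/p} dμ (`lintegral_rpow_le_of_holder`). Multiplying by |F(0)|, taking expectations and
inserting the inverse estimate yields E[|F(0)|/M_s^{1/p}] ≤ √π a_0 Z^{-1/p}, and the moment bound
replaces Z by E‖F‖^p.

If E‖F‖^p = ∞, the case s = R of the bound forces |F(0)|/M_R^{1/p} = 0 almost surely; as F(0) ≠ 0
almost surely, M_R = ∞ almost surely. So (iv) implies (ii). The remaining implications are the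
inequality of geometric and arithmetic means and trivialities. -/

/-! ### The standard complex Gaussian: moments, characteristic function, rotation invariance. -/

lemma integral_norm_rpow_mul_exp_neg_sq {q : ℝ} (hq : -2 < q) :
    ∫ z : ℂ, ‖z‖ ^ q * Real.exp (-‖z‖ ^ 2) = Real.pi * Real.Gamma (1 + q / 2) := by
  have h := Complex.integral_rpow_mul_exp_neg_rpow (p := 2) (q := q) (by norm_num) hq
  simp only [Real.rpow_two] at h
  rw [h]
  congr 2
  · ring
  · ring

lemma measurable_gaussian_density :
    Measurable fun z : ℂ => ENNReal.ofReal (Real.exp (-‖z‖ ^ 2) / Real.pi) := by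
  fun_prop

lemma lintegral_norm_rpow_stdComplexGaussian {q : ℝ} (hq : -2 < q) :
    ∫⁻ z, ENNReal.ofReal (‖z‖ ^ q) ∂stdComplexGaussian
      = ENNReal.ofReal (Real.Gamma (1 + q / 2)) := by
  have hG : 0 < Real.Gamma (1 + q / 2) := Real.Gamma_pos_of_pos (by linarith)
  have h := integral_norm_rpow_mul_exp_neg_sq hq
  have hint : Integrable fun z : ℂ => ‖z‖ ^ q * Real.exp (-‖z‖ ^ 2) := by
    -- A non-integrable function has Bochner integral 0, while the value computed in `h` is
    -- positive.
    by_contra hc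
    rw [integral_undef hc] at h
    have := mul_pos Real.pi_pos hG
    linarith
  rw [stdComplexGaussian, lintegral_withDensity_eq_lintegral_mul _ measurable_gaussian_density
    (by fun_prop)]
  have hrew : ∀ z : ℂ, ((fun z : ℂ => ENNReal.ofReal (Real.exp (-‖z‖ ^ 2) / Real.pi)) *
      (fun z : ℂ => ENNReal.ofReal (‖z‖ ^ q))) z
      = ENNReal.ofReal ((‖z‖ ^ q * Real.exp (-‖z‖ ^ 2)) / Real.pi) := by
    intro z
    rw [Pi.mul_apply, ← ENNReal.ofReal_mul (by positivity)]
    congr 1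
    ring
  simp_rw [hrew]
  rw [← ofReal_integral_eq_lintegral_ofReal (hint.div_const _)
    (Eventually.of_forall fun z => by positivity), integral_div, h]
  congr 1
  field_simp

instance : IsProbabilityMeasure stdComplexGaussian := by
  constructor
  have h := lintegral_norm_rpow_stdComplexGaussian (q := 0) (by norm_num)
  simpa using h

lemma stdComplexGaussian_ae_ne_zero : ∀ᵐ z ∂stdComplexGaussian, z ≠ 0 := by
  have h : stdComplexGaussian ≪ volume := withDensity_absolutelyContinuous _ _
  exact h.ae_le (Measure.ae_ne volume 0)

lemma lintegral_enorm_sq_stdComplexGaussian :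
    ∫⁻ z, ‖z‖ₑ ^ 2 ∂stdComplexGaussian = 1 := by
  have h := lintegral_norm_rpow_stdComplexGaussian (q := 2) (by norm_num)
  have h2 : Real.Gamma (1 + 2 / 2) = 1 := by norm_num
  rw [h2, ENNReal.ofReal_one] at h
  rw [← h]
  refine lintegral_congr fun z => ?_
  rw [Real.rpow_two, ENNReal.ofReal_pow (norm_nonneg z), ofReal_norm]

lemma lintegral_enorm_inv_stdComplexGaussian :
    ∫⁻ z, ‖z‖ₑ⁻¹ ∂stdComplexGaussian = ENNReal.ofReal √Real.pi := by
  have h := lintegral_norm_rpow_stdComplexGaussian (q := -1) (by norm_num)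
  have h2 : Real.Gamma (1 + -1 / 2) = √Real.pi := by
    rw [← Real.Gamma_one_half_eq]; norm_num
  rw [h2] at h
  rw [← h]
  -- The integrands differ at 0, where the real power is 0 and the extended inverse is `⊤`.
  refine lintegral_congr_ae ?_
  filter_upwards [stdComplexGaussian_ae_ne_zero] with z hz
  rw [Real.rpow_neg_one, ENNReal.ofReal_inv_of_pos (norm_pos_iff.2 hz), ofReal_norm]

lemma lintegral_enorm_stdComplexGaussian :
    ∫⁻ z, ‖z‖ₑ ∂stdComplexGaussian = ENNReal.ofReal (√Real.pi / 2) := by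
  have h := lintegral_norm_rpow_stdComplexGaussian (q := 1) (by norm_num)
  have h2 : Real.Gamma (1 + 1 / 2) = √Real.pi / 2 := by
    rw [add_comm, Real.Gamma_add_one (by norm_num), Real.Gamma_one_half_eq]; ring
  rw [h2] at h
  rw [← h]
  refine lintegral_congr fun z => ?_
  rw [Real.rpow_one, ofReal_norm]

lemma charFun_stdComplexGaussian (t : ℂ) :
    charFun stdComplexGaussian t = Complex.exp (-(‖t‖ : ℂ) ^ 2 / 4) := by
  have h := GaussianFourier.integral_cexp_neg_mul_sq_norm_add (V := ℂ) (b := 1) (by simp)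
    Complex.I t
  rw [charFun_apply, stdComplexGaussian,
    integral_withDensity_eq_integral_toReal_smul measurable_gaussian_density (by simp)]
  have hrew : ∀ z : ℂ, (ENNReal.ofReal (Real.exp (-‖z‖ ^ 2) / Real.pi)).toReal •
      Complex.exp (⟪z, t⟫ * Complex.I) =
      (Real.pi : ℂ)⁻¹ * Complex.exp (-1 * (‖z‖ : ℂ) ^ 2 + Complex.I * ⟪t, z⟫) := by
    intro z
    rw [ENNReal.toReal_ofReal (by positivity), Complex.real_smul, Complex.exp_add,
      real_inner_comm, mul_comm Complex.I]
    push_cast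
    ring_nf
  simp_rw [hrew]
  rw [integral_const_mul, h]
  simp only [Complex.finrank_real_complex, div_one, Complex.I_sq]
  norm_num

lemma charFun_map_const_mul_stdComplexGaussian (c t : ℂ) :
    charFun (stdComplexGaussian.map (c * ·)) t
      = Complex.exp (-((‖c‖ ^ 2 : ℝ) : ℂ) * (‖t‖ : ℂ) ^ 2 / 4) := by
  rw [charFun_apply, integral_map (by fun_prop) (by fun_prop)]
  have hrew : ∀ z : ℂ, ⟪c * z, t⟫ = ⟪z, (starRingEnd ℂ) c * t⟫ := by
    intro z
    simp [Complex.inner]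
    ring
  simp_rw [hrew]
  rw [← charFun_apply, charFun_stdComplexGaussian]
  congr 1
  simp
  ring_nf

/-- Makes the rotation invariance of centred Gaussian measures available. The covariance is half the
inner product, since each real coordinate has variance 1/2. -/
instance : IsGaussian stdComplexGaussian := by
  refine isGaussian_iff_gaussian_charFun.2 ⟨0, (1 / 2 : ℝ) • innerSL ℝ, ?_, fun t => ?_⟩
  · refine ⟨⟨fun x y => ?_⟩, ⟨fun x => ?_⟩⟩
    · simp [innerSL_apply_apply ℝ, real_inner_comm]
    · simp [innerSL_apply_apply ℝ, -Complex.inner]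
  · rw [charFun_stdComplexGaussian]
    congr 1
    simp [innerSL_apply_apply ℝ, -Complex.inner]
    ring

lemma stdComplexGaussian_map_neg :
    stdComplexGaussian.map (fun z => -z) = stdComplexGaussian := by
  refine Measure.ext_of_charFun ?_
  ext t
  have h := charFun_map_const_mul_stdComplexGaussian (-1) t
  simp only [neg_mul, one_mul] at h
  rw [h, charFun_stdComplexGaussian]
  simp

lemma integral_id_stdComplexGaussian : ∫ z, id z ∂stdComplexGaussian = 0 := by
  have h : ∫ z, id z ∂stdComplexGaussian = -∫ z, id z ∂stdComplexGaussian := by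
    conv_lhs => rw [← stdComplexGaussian_map_neg]
    rw [integral_map (by fun_prop) (by fun_prop), ← integral_neg]
    rfl
  linear_combination (1 / 2 : ℂ) * h

lemma map_rotation_stdComplexGaussian (θ : ℝ) :
    (stdComplexGaussian.prod stdComplexGaussian).map (ContinuousLinearMap.rotation θ)
      = stdComplexGaussian.prod stdComplexGaussian :=
  IsGaussian.map_rotation_eq_self integral_id_stdComplexGaussian θ

/-! ### Finite Gaussian sums: ratio and moment estimates. -/

variable {Ω : Type*} [MeasurableSpace Ω] {P : Measure Ω} {ζ : ℕ → Ω → ℂ}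

/-- A finite linear combination of independent standard complex Gaussians is distributed like a
multiple of a standard complex Gaussian. -/
lemma map_sum_const_mul [IsProbabilityMeasure P] (hζmeas : ∀ n, Measurable (ζ n))
    (hζindep : iIndepFun ζ P) (hζlaw : ∀ n, P.map (ζ n) = stdComplexGaussian)
    (c : ℕ → ℂ) (s : Finset ℕ) :
    P.map (fun ω => ∑ n ∈ s, c n * ζ n ω)
      = stdComplexGaussian.map ((√(∑ n ∈ s, ‖c n‖ ^ 2) : ℂ) * ·) := by
  have hind : iIndepFun (fun n ω => c n * ζ n ω) P :=
    hζindep.comp (fun n z => c n * z) (fun n => by fun_prop)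
  have hm : ∀ n, Measurable (fun ω => c n * ζ n ω) := fun n => (hζmeas n).const_mul _
  have hlaw : ∀ n, P.map (fun ω => c n * ζ n ω) = stdComplexGaussian.map (c n * ·) := by
    intro n
    rw [← hζlaw n, Measure.map_map (by fun_prop) (hζmeas n)]
    rfl
  have : IsFiniteMeasure (P.map (fun ω => ∑ n ∈ s, c n * ζ n ω)) := inferInstance
  refine Measure.ext_of_charFun ?_
  rw [iIndepFun.charFun_map_fun_finsetSum_eq_prod (fun i _ => (hm i).aemeasurable)
    (hind.restrict s)]
  ext t
  rw [Finset.prod_apply, charFun_map_const_mul_stdComplexGaussian]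
  simp_rw [hlaw, charFun_map_const_mul_stdComplexGaussian]
  rw [← Complex.exp_sum]
  congr 1
  rw [Complex.norm_real, Real.norm_of_nonneg (Real.sqrt_nonneg _),
    Real.sq_sqrt (Finset.sum_nonneg fun i _ => by positivity)]
  push_cast
  rw [← Finset.sum_div, ← Finset.sum_mul, Finset.sum_neg_distrib]

/-- The law of v is symmetric, so twice the integral is that of |cu - sv| + |cu + sv|. The
inequality 2t ≤ 1 + t² and the parallelogram law bound this sum by 1 + |cu|² + |sv|², and E|v|² = 1.
-/
lemma two_mul_lintegral_enorm_sub_le (c s : ℝ) (u : ℂ) :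
    2 * ∫⁻ v, ‖(c : ℂ) * u - s * v‖ₑ ∂stdComplexGaussian
      ≤ ENNReal.ofReal (1 + s ^ 2) + ENNReal.ofReal (c ^ 2) * ‖u‖ₑ ^ 2 := by
  have hneg : ∫⁻ v, ‖(c : ℂ) * u - s * v‖ₑ ∂stdComplexGaussian
      = ∫⁻ v, ‖(c : ℂ) * u + s * v‖ₑ ∂stdComplexGaussian := by
    conv_lhs => rw [← stdComplexGaussian_map_neg]
    rw [lintegral_map (by fun_prop) (by fun_prop)]
    simp
  rw [two_mul]
  nth_rewrite 2 [hneg]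
  rw [← lintegral_add_left (by fun_prop)]
  calc _ ≤ ∫⁻ v, (1 + ENNReal.ofReal (c ^ 2) * ‖u‖ₑ ^ 2
          + ENNReal.ofReal (s ^ 2) * ‖v‖ₑ ^ 2) ∂stdComplexGaussian := by
        refine lintegral_mono fun v => ?_
        rw [← ofReal_norm, ← ofReal_norm, ← ofReal_norm, ← ofReal_norm,
          ← ENNReal.ofReal_add (norm_nonneg _) (norm_nonneg _),
          ← ENNReal.ofReal_pow (norm_nonneg _), ← ENNReal.ofReal_pow (norm_nonneg _),
          ← ENNReal.ofReal_mul (sq_nonneg _), ← ENNReal.ofReal_mul (sq_nonneg _),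
          ← ENNReal.ofReal_one, ← ENNReal.ofReal_add zero_le_one (by positivity),
          ← ENNReal.ofReal_add (by positivity) (by positivity)]
        refine ENNReal.ofReal_le_ofReal ?_
        have h := parallelogram_law_with_norm ℝ ((c : ℂ) * u) (s * v)
        simp only [norm_mul, Complex.norm_real, Real.norm_eq_abs] at h
        have hc : |c| * ‖u‖ * (|c| * ‖u‖) = c ^ 2 * ‖u‖ ^ 2 := by
          rw [← sq_abs c]; ring
        have hs : |s| * ‖v‖ * (|s| * ‖v‖) = s ^ 2 * ‖v‖ ^ 2 := by
          rw [← sq_abs s]; ring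
        nlinarith [sq_nonneg (‖(c : ℂ) * u - s * v‖ - 1), sq_nonneg (‖(c : ℂ) * u + s * v‖ - 1)]
    _ = _ := by
        rw [lintegral_add_left (by fun_prop), lintegral_const_mul _ (by fun_prop),
          lintegral_enorm_sq_stdComplexGaussian, lintegral_const, measure_univ, mul_one, mul_one,
          ENNReal.ofReal_add zero_le_one (sq_nonneg s), ENNReal.ofReal_one]
        ring

/-- Integrating out the second coordinate and dividing by |u| leaves (1 + s²) E|u|⁻¹ + c² E|u| = √π
(2 - c²/2), at most twice the claimed constant. -/
lemma lintegral_enorm_sub_div_le {c s : ℝ} (hcs : c ^ 2 + s ^ 2 = 1) :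
    ∫⁻ q : ℂ × ℂ, ‖(c : ℂ) * q.1 - s * q.2‖ₑ * ‖q.1‖ₑ⁻¹
        ∂(stdComplexGaussian.prod stdComplexGaussian) ≤ ENNReal.ofReal √Real.pi := by
  have h2 : 2 * ∫⁻ q : ℂ × ℂ, ‖(c : ℂ) * q.1 - s * q.2‖ₑ * ‖q.1‖ₑ⁻¹
        ∂(stdComplexGaussian.prod stdComplexGaussian) ≤ 2 * ENNReal.ofReal √Real.pi := by
    rw [lintegral_prod _ (by fun_prop), ← lintegral_const_mul' _ _ (by simp)]
    calc _ = ∫⁻ u, (2 * ∫⁻ v, ‖(c : ℂ) * u - s * v‖ₑ ∂stdComplexGaussian) * ‖u‖ₑ⁻¹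
            ∂stdComplexGaussian := by
          refine lintegral_congr fun u => ?_
          dsimp only
          rw [lintegral_mul_const _ (by fun_prop), mul_assoc]
      _ ≤ ∫⁻ u, (ENNReal.ofReal (1 + s ^ 2) * ‖u‖ₑ⁻¹ + ENNReal.ofReal (c ^ 2) * ‖u‖ₑ)
            ∂stdComplexGaussian := by
          refine lintegral_mono fun u => ?_
          calc _ ≤ (ENNReal.ofReal (1 + s ^ 2) + ENNReal.ofReal (c ^ 2) * ‖u‖ₑ ^ 2) * ‖u‖ₑ⁻¹ := by
                gcongr
                exact two_mul_lintegral_enorm_sub_le c s u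
            _ = ENNReal.ofReal (1 + s ^ 2) * ‖u‖ₑ⁻¹
                + ENNReal.ofReal (c ^ 2) * ‖u‖ₑ * (‖u‖ₑ * ‖u‖ₑ⁻¹) := by ring
            _ ≤ ENNReal.ofReal (1 + s ^ 2) * ‖u‖ₑ⁻¹ + ENNReal.ofReal (c ^ 2) * ‖u‖ₑ * 1 := by
                gcongr
                exact ENNReal.mul_inv_le_one _
            _ = _ := by rw [mul_one]
      _ = ENNReal.ofReal ((1 + s ^ 2) * √Real.pi + c ^ 2 * (√Real.pi / 2)) := by
          rw [lintegral_add_left (by fun_prop), lintegral_const_mul _ (by fun_prop),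
            lintegral_const_mul _ (by fun_prop), lintegral_enorm_inv_stdComplexGaussian,
            lintegral_enorm_stdComplexGaussian, ← ENNReal.ofReal_mul (by positivity),
            ← ENNReal.ofReal_mul (by positivity), ← ENNReal.ofReal_add (by positivity)
            (by positivity)]
      _ ≤ ENNReal.ofReal (2 * √Real.pi) := by
          refine ENNReal.ofReal_le_ofReal ?_
          have hs : s ^ 2 = 1 - c ^ 2 := by linarith
          rw [hs]
          nlinarith [mul_nonneg (sq_nonneg c) (Real.sqrt_nonneg Real.pi)]
      _ = _ := by rw [ENNReal.ofReal_mul zero_le_two]; simp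
  exact (ENNReal.mul_le_mul_iff_right (by simp) (by simp)).1 h2

/-- With S = √(a² + b²) and (a, b) = S (cos θ, sin θ), rotation by θ turns the denominator into S
times the first coordinate and the numerator into a unit-length real combination of both
coordinates. The product law is invariant under the rotation. -/
lemma lintegral_enorm_fst_div_le {a : ℝ} (b : ℝ) (ha : 0 < a) :
    ∫⁻ q : ℂ × ℂ, ‖q.1‖ₑ * ‖(a : ℂ) * q.1 + b * q.2‖ₑ⁻¹
        ∂(stdComplexGaussian.prod stdComplexGaussian)
      ≤ ENNReal.ofReal (√Real.pi / √(a ^ 2 + b ^ 2)) := by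
  set S := √(a ^ 2 + b ^ 2) with hS
  have hpos : 0 < a ^ 2 + b ^ 2 := by positivity
  have hS0 : 0 < S := Real.sqrt_pos.2 hpos
  have hSS : S ^ 2 = a ^ 2 + b ^ 2 := Real.sq_sqrt hpos.le
  obtain ⟨θ, hc, hs⟩ : ∃ θ : ℝ, Real.cos θ = a / S ∧ Real.sin θ = b / S := by
    have hn : ‖(⟨a, b⟩ : ℂ)‖ = S := by
      rw [Complex.norm_def, Complex.normSq_apply, hS]; congr 1; simp; ring
    refine ⟨Complex.arg ⟨a, b⟩, ?_, ?_⟩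
    · rw [Complex.cos_arg (by rw [← norm_pos_iff, hn]; exact hS0), hn]
    · rw [Complex.sin_arg, hn]
  have haS : a = S * Real.cos θ := by rw [hc]; field_simp
  have hbS : b = S * Real.sin θ := by rw [hs]; field_simp
  have hrew : ∀ q : ℂ × ℂ, ‖q.1‖ₑ * ‖(a : ℂ) * q.1 + b * q.2‖ₑ⁻¹ =
      (fun q : ℂ × ℂ => ENNReal.ofReal S⁻¹ * (‖(Real.cos θ : ℂ) * q.1 - Real.sin θ * q.2‖ₑ *
        ‖q.1‖ₑ⁻¹)) (ContinuousLinearMap.rotation θ q) := by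
    rintro ⟨x, y⟩
    simp only [ContinuousLinearMap.rotation_apply, Complex.real_smul]
    have h1 : (Real.cos θ : ℂ) * (Real.cos θ * x + Real.sin θ * y)
        - Real.sin θ * (((-Real.sin θ : ℝ) : ℂ) * x + Real.cos θ * y) = x := by
      have : (Real.cos θ : ℂ) ^ 2 + (Real.sin θ : ℂ) ^ 2 = 1 := by
        exact_mod_cast Real.cos_sq_add_sin_sq θ
      push_cast at this ⊢
      linear_combination x * this
    have h2 : (a : ℂ) * x + b * y = S * (Real.cos θ * x + Real.sin θ * y) := by
      rw [haS, hbS]; push_cast; ring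
    rw [h1, h2, enorm_mul, ENNReal.mul_inv (Or.inr (by simp)) (Or.inl (by simp)),
      ENNReal.ofReal_inv_of_pos hS0]
    have h3 : ‖(S : ℂ)‖ₑ = ENNReal.ofReal S := by
      rw [← ofReal_norm, Complex.norm_real, Real.norm_of_nonneg hS0.le]
    rw [h3]
    ring
  simp_rw [hrew]
  rw [← lintegral_map (f := fun q : ℂ × ℂ => ENNReal.ofReal S⁻¹ *
    (‖(Real.cos θ : ℂ) * q.1 - Real.sin θ * q.2‖ₑ * ‖q.1‖ₑ⁻¹)) (by fun_prop)
    (ContinuousLinearMap.rotation θ).continuous.measurable,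
    map_rotation_stdComplexGaussian, lintegral_const_mul' _ _ (by simp)]
  calc _ ≤ ENNReal.ofReal S⁻¹ * ENNReal.ofReal √Real.pi := by
        gcongr
        exact lintegral_enorm_sub_div_le (Real.cos_sq_add_sin_sq θ)
    _ = _ := by
        rw [← ENNReal.ofReal_mul (by positivity)]
        congr 1
        field_simp

/-- The sum over `s` is independent of ζ_0 and has the law of b times a standard Gaussian, which
reduces the estimate to a pair of independent Gaussians. -/
lemma lintegral_enorm_div_sum_le [IsProbabilityMeasure P] (hζmeas : ∀ n, Measurable (ζ n))
    (hζindep : iIndepFun ζ P) (hζlaw : ∀ n, P.map (ζ n) = stdComplexGaussian)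
    {a : ℝ} (ha : 0 < a) (c : ℕ → ℂ) {s : Finset ℕ} (hs : 0 ∉ s) :
    ∫⁻ ω, ‖ζ 0 ω‖ₑ * ‖(a : ℂ) * ζ 0 ω + ∑ n ∈ s, c n * ζ n ω‖ₑ⁻¹ ∂P
      ≤ ENNReal.ofReal (√Real.pi / √(a ^ 2 + ∑ n ∈ s, ‖c n‖ ^ 2)) := by
  set b := √(∑ n ∈ s, ‖c n‖ ^ 2) with hb
  have hb2 : ∑ n ∈ s, ‖c n‖ ^ 2 = b ^ 2 :=
    (Real.sq_sqrt (Finset.sum_nonneg fun i _ => by positivity)).symm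
  rw [hb2]
  -- Setting the coefficient at 0 to 1 puts ζ_0 and the terms of the sum into a single independent
  -- family.
  let d : ℕ → ℂ := fun n => if n = 0 then 1 else c n
  have hd : ∀ n ∈ s, d n = c n := fun n hn => by
    simp only [d]; rw [if_neg]; rintro rfl; exact hs hn
  have hm : ∀ n, Measurable (fun ω => d n * ζ n ω) := fun n => (hζmeas n).const_mul _
  have hind : iIndepFun (fun n ω => d n * ζ n ω) P :=
    hζindep.comp (fun n z => d n * z) (fun n => by fun_prop)
  have hG : (∑ n ∈ s, fun ω => d n * ζ n ω) = fun ω => ∑ n ∈ s, c n * ζ n ω := by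
    ext ω
    rw [Finset.sum_apply]
    exact Finset.sum_congr rfl fun n hn => by rw [hd n hn]
  have h0 : (fun ω => d 0 * ζ 0 ω) = ζ 0 := by ext ω; simp [d]
  have hi := (hind.indepFun_finsetSum_of_notMem hm hs).symm
  have hGm : Measurable fun ω => ∑ n ∈ s, c n * ζ n ω :=
    Finset.measurable_sum _ fun n _ => (hζmeas n).const_mul _
  rw [hG, h0, indepFun_iff_map_prod_eq_prod_map_map (hζmeas 0).aemeasurable hGm.aemeasurable,
    hζlaw, map_sum_const_mul hζmeas hζindep hζlaw, ← hb] at hi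
  have hmap : stdComplexGaussian.prod (stdComplexGaussian.map ((b : ℂ) * ·))
      = (stdComplexGaussian.prod stdComplexGaussian).map (Prod.map id ((b : ℂ) * ·)) := by
    rw [← Measure.map_prod_map _ _ measurable_id (by fun_prop), Measure.map_id]
  refine (lintegral_map (f := fun q : ℂ × ℂ => ‖q.1‖ₑ * ‖(a : ℂ) * q.1 + q.2‖ₑ⁻¹) (by fun_prop)
    ((hζmeas 0).prodMk hGm)).symm.trans_le ?_
  rw [hi, hmap, lintegral_map (by fun_prop) (by fun_prop)]
  exact lintegral_enorm_fst_div_le b ha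

lemma lintegral_norm_sum_rpow [IsProbabilityMeasure P] (hζmeas : ∀ n, Measurable (ζ n))
    (hζindep : iIndepFun ζ P) (hζlaw : ∀ n, P.map (ζ n) = stdComplexGaussian)
    (c : ℕ → ℂ) (s : Finset ℕ) {p : ℝ} (hp : 0 < p) :
    ∫⁻ ω, ENNReal.ofReal (‖∑ n ∈ s, c n * ζ n ω‖ ^ p) ∂P
      = ENNReal.ofReal (Real.Gamma (1 + p / 2) * (∑ n ∈ s, ‖c n‖ ^ 2) ^ (p / 2)) := by
  have hGm : Measurable fun ω => ∑ n ∈ s, c n * ζ n ω :=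
    Finset.measurable_sum _ fun n _ => (hζmeas n).const_mul _
  have hK : 0 ≤ ∑ n ∈ s, ‖c n‖ ^ 2 := Finset.sum_nonneg fun i _ => by positivity
  rw [← lintegral_map (f := fun z : ℂ => ENNReal.ofReal (‖z‖ ^ p)) (by fun_prop) hGm,
    map_sum_const_mul hζmeas hζindep hζlaw, lintegral_map (by fun_prop) (by fun_prop)]
  have hrew : ∀ z : ℂ, ENNReal.ofReal (‖(√(∑ n ∈ s, ‖c n‖ ^ 2) : ℂ) * z‖ ^ p) =
      ENNReal.ofReal ((∑ n ∈ s, ‖c n‖ ^ 2) ^ (p / 2)) * ENNReal.ofReal (‖z‖ ^ p) := by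
    intro z
    rw [← ENNReal.ofReal_mul (by positivity), norm_mul, Complex.norm_real,
      Real.norm_of_nonneg (Real.sqrt_nonneg _), Real.mul_rpow (by positivity) (by positivity),
      Real.sqrt_eq_rpow, ← Real.rpow_mul hK]
    congr 3
    ring
  simp_rw [hrew]
  rw [lintegral_const_mul' _ _ (by simp), lintegral_norm_rpow_stdComplexGaussian (by linarith),
    ← ENNReal.ofReal_mul (by positivity), mul_comm]

/-! ### The random series: measurability, almost sure convergence, analyticity. -/

lemma polarPoint_eq_circleMap (r θ : ℝ) : polarPoint r θ = circleMap 0 r (2 * Real.pi * θ) := by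
  rw [polarPoint, circleMap, zero_add]
  congr 2
  push_cast
  ring

lemma norm_polarPoint {r : ℝ} (hr : 0 ≤ r) (θ : ℝ) : ‖polarPoint r θ‖ = r := by
  rw [polarPoint_eq_circleMap, norm_circleMap_zero, abs_of_nonneg hr]

lemma enorm_polarPoint_lt {R : ℝ≥0∞} {r : ℝ} (hr : r ∈ radialInterval R) (θ : ℝ) :
    ‖polarPoint r θ‖ₑ < R := by
  rw [← ofReal_norm, norm_polarPoint hr.1.le]
  exact hr.2

lemma measurable_polarPoint : Measurable fun q : ℝ × ℝ => polarPoint q.1 q.2 := by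
  unfold polarPoint
  fun_prop

lemma measurableSet_radialInterval (s : ℝ≥0∞) : MeasurableSet (radialInterval s) :=
  (measurableSet_lt measurable_const measurable_id).inter
    (measurableSet_lt ENNReal.measurable_ofReal measurable_const)

lemma measurable_gaussianSeries (a : ℕ → ℝ) :
    Measurable fun q : (ℕ → ℂ) × ℂ => gaussianSeries a q.1 q.2 := by
  unfold gaussianSeries
  refine Measurable.tsum fun n => ?_
  fun_prop

lemma gaussianSeries_zero (a : ℕ → ℝ) (w : ℕ → ℂ) : gaussianSeries a w 0 = a 0 * w 0 := by
  rw [gaussianSeries, tsum_eq_single 0]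
  · simp
  · intro n hn
    simp [hn]

lemma summable_mul_pow_of_rootLimsup {a : ℕ → ℝ} (ha : ∀ n, 0 ≤ a n) {R : ℝ≥0∞}
    (hR : R⁻¹ = rootLimsup a) {r : ℝ} (hr : 0 ≤ r) (hrR : ENNReal.ofReal r < R) :
    Summable fun n => a n * r ^ n := by
  -- Root test: with r < ρ < R, eventually a_n ≤ ρ^{-n}, so the terms are dominated by the geometric
  -- series of r/ρ.
  obtain ⟨ρ, hrρ, hρR⟩ := ENNReal.lt_iff_exists_nnreal_btwn.1 hrR
  have hrρ' : r < ρ := (ENNReal.ofReal_lt_iff_lt_toReal hr (by simp)).1 hrρ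
  have hρ : (0 : ℝ) < ρ := hr.trans_lt hrρ'
  have hlim : rootLimsup a < (ρ : ℝ≥0∞)⁻¹ := by
    rw [← hR]
    exact ENNReal.inv_lt_inv.2 hρR
  have hev := eventually_lt_of_limsup_lt hlim
  have hgeo : Summable fun n : ℕ => (r / ρ) ^ n :=
    summable_geometric_of_lt_one (by positivity) ((div_lt_one hρ).2 hrρ')
  refine Summable.of_norm_bounded_eventually_nat hgeo ?_
  filter_upwards [hev, eventually_gt_atTop 0] with n hn hn0
  have h1 : a n ^ (1 / (n : ℝ)) ≤ (ρ : ℝ)⁻¹ := by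
    have h2 : (ρ : ℝ≥0∞)⁻¹ = ENNReal.ofReal (ρ : ℝ)⁻¹ := by
      rw [ENNReal.ofReal_inv_of_pos hρ, ENNReal.ofReal_coe_nnreal]
    rw [h2] at hn
    exact ((ENNReal.ofReal_lt_ofReal_iff (by positivity)).1 hn).le
  have h3 : a n ≤ (ρ : ℝ)⁻¹ ^ n := by
    calc a n = (a n ^ (1 / (n : ℝ))) ^ n := by
          rw [one_div, Real.rpow_inv_natCast_pow (ha n) hn0.ne']
      _ ≤ _ := pow_le_pow_left₀ (Real.rpow_nonneg (ha n) _) h1 n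
  rw [Real.norm_of_nonneg (mul_nonneg (ha n) (pow_nonneg hr n)), div_pow, div_eq_inv_mul,
    ← inv_pow]
  exact mul_le_mul_of_nonneg_right h3 (pow_nonneg hr n)

/-- The coefficients `a n * w n` define an absolutely convergent power series in `|z| < R`. -/
def ConvergesIn (a : ℕ → ℝ) (R : ℝ≥0∞) (w : ℕ → ℂ) : Prop :=
  ∀ r : ℝ, 0 ≤ r → ENNReal.ofReal r < R → Summable fun n => ‖(a n : ℂ) * w n‖ * r ^ n

lemma ConvergesIn.summable {a : ℕ → ℝ} {R : ℝ≥0∞} {w : ℕ → ℂ} (h : ConvergesIn a R w) {z : ℂ}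
    (hz : ‖z‖ₑ < R) : Summable fun n : ℕ => (a n : ℂ) * w n * z ^ n := by
  refine Summable.of_norm ?_
  simp_rw [norm_mul _ (z ^ _), norm_pow]
  exact h ‖z‖ (norm_nonneg z) (by rwa [ofReal_norm])

lemma ConvergesIn.analyticAt {a : ℕ → ℝ} {R : ℝ≥0∞} {w : ℕ → ℂ} (h : ConvergesIn a R w) {z : ℂ}
    (hz : ‖z‖ₑ < R) : AnalyticAt ℂ (gaussianSeries a w) z := by
  obtain ⟨ρ, hzρ, hρR⟩ := ENNReal.lt_iff_exists_nnreal_btwn.1 hz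
  have hzρ' : ‖z‖ < ρ := by
    rw [← ofReal_norm] at hzρ
    exact (ENNReal.ofReal_lt_iff_lt_toReal (norm_nonneg z) (by simp)).1 hzρ
  have hd : DifferentiableOn ℂ (gaussianSeries a w) (Metric.ball 0 ρ) := by
    refine Complex.differentiableOn_tsum_of_summable_norm
      (h ρ ρ.2 (by rwa [ENNReal.ofReal_coe_nnreal])) (fun n => by fun_prop) Metric.isOpen_ball ?_
    intro n x hx
    rw [norm_mul, norm_pow]
    gcongr
    exact (mem_ball_zero_iff.1 hx).le
  exact hd.analyticAt (Metric.isOpen_ball.mem_nhds (mem_ball_zero_iff.2 hzρ'))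

lemma log_norm_rpow (z : ℂ) {p : ℝ} (hp : 0 < p) : Real.log (‖z‖ ^ p) = p * Real.log ‖z‖ := by
  rcases eq_or_ne z 0 with rfl | hz
  · simp [Real.zero_rpow hp.ne']
  · exact Real.log_rpow (norm_pos_iff.2 hz) p

/-- The logarithm of the modulus of a meromorphic function is integrable on circles even through
zeros, and this includes the identically zero function. -/
lemma ConvergesIn.intervalIntegrable_log {a : ℕ → ℝ} {R : ℝ≥0∞} {w : ℕ → ℂ}
    (h : ConvergesIn a R w) {r : ℝ} (hr : r ∈ radialInterval R) :
    IntervalIntegrable (fun θ => Real.log ‖gaussianSeries a w (polarPoint r θ)‖) volume 0 1 := by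
  have hmer : MeromorphicOn (gaussianSeries a w) (Metric.sphere 0 r) := by
    intro z hz
    refine (h.analyticAt ?_).meromorphicAt
    rw [← ofReal_norm, mem_sphere_zero_iff_norm.1 hz]
    exact hr.2
  have hc : IntervalIntegrable
      (fun θ => Real.log ‖gaussianSeries a w (circleMap 0 r θ)‖) volume 0 (2 * Real.pi) :=
    hmer.circleIntegrable_log_norm_of_nonneg hr.1.le
  have h2 := hc.comp_mul_left (c := 2 * Real.pi)
  simp_rw [← polarPoint_eq_circleMap] at h2
  rwa [zero_div, div_self (by positivity)] at h2

/-- The variance of `F (r e^{iθ})`. -/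
noncomputable def seriesVariance (a : ℕ → ℝ) (r : ℝ) : ℝ≥0∞ :=
  ∑' n, ENNReal.ofReal ((a n * r ^ n) ^ 2)

lemma measurable_seriesVariance (a : ℕ → ℝ) : Measurable (seriesVariance a) := by
  unfold seriesVariance
  refine Measurable.tsum fun n => ?_
  fun_prop

lemma seriesVariance_lt_top {a : ℕ → ℝ} (ha : ∀ n, 0 ≤ a n) {R : ℝ≥0∞}
    (hR : R⁻¹ = rootLimsup a) {r : ℝ} (hr : 0 ≤ r) (hrR : ENNReal.ofReal r < R) :
    seriesVariance a r < ⊤ := by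
  have h := summable_mul_pow_of_rootLimsup ha hR hr hrR
  have h2 : Summable fun n => (a n * r ^ n) ^ 2 := by
    refine Summable.of_norm_bounded_eventually_nat h ?_
    filter_upwards [h.tendsto_atTop_zero.eventually_lt_const zero_lt_one] with n hn
    have h0 : 0 ≤ a n * r ^ n := mul_nonneg (ha n) (pow_nonneg hr n)
    rw [Real.norm_of_nonneg (sq_nonneg _)]
    nlinarith
  exact h2.tsum_ofReal_lt_top

lemma seriesVariance_ne_zero {a : ℕ → ℝ} (ha0 : a 0 ≠ 0) (r : ℝ) : seriesVariance a r ≠ 0 := by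
  intro h
  have h1 := ENNReal.tsum_eq_zero.1 h 0
  rw [ENNReal.ofReal_eq_zero] at h1
  have : 0 < (a 0 * r ^ 0) ^ 2 := by simp; positivity
  linarith

lemma tendsto_seriesVariance (a : ℕ → ℝ) (r : ℝ) :
    Tendsto (fun N => ENNReal.ofReal (∑ n ∈ Finset.range N, (a n * r ^ n) ^ 2)) atTop
      (𝓝 (seriesVariance a r)) := by
  simp_rw [ENNReal.ofReal_sum_of_nonneg (fun n _ => sq_nonneg _)]
  exact ENNReal.tendsto_nat_tsum _

/-- At a fixed radius the expected sum of absolute values is finite, because E|ζ_n| does not depend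
on n. Rational radii give countably many events, and comparison with a larger rational radius covers
all the others. -/
lemma ae_convergesIn {a : ℕ → ℝ} (ha : ∀ n, 0 ≤ a n) {R : ℝ≥0∞}
    (hR : R⁻¹ = rootLimsup a) (hζmeas : ∀ n, Measurable (ζ n))
    (hζlaw : ∀ n, P.map (ζ n) = stdComplexGaussian) :
    ∀ᵐ ω ∂P, ConvergesIn a R (fun n => ζ n ω) := by
  have hq : ∀ q : ℚ, 0 ≤ (q : ℝ) → ENNReal.ofReal q < R →
      ∀ᵐ ω ∂P, Summable fun n => ‖(a n : ℂ) * ζ n ω‖ * (q : ℝ) ^ n := by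
    intro q hq0 hqR
    have hs := summable_mul_pow_of_rootLimsup ha hR hq0 hqR
    have hint : ∫⁻ ω, ∑' n, ‖ζ n ω‖ₑ * ENNReal.ofReal (a n * (q : ℝ) ^ n) ∂P ≠ ⊤ := by
      rw [lintegral_tsum (fun n => by fun_prop)]
      have hn : ∀ n, ∫⁻ ω, ‖ζ n ω‖ₑ * ENNReal.ofReal (a n * (q : ℝ) ^ n) ∂P
          = ENNReal.ofReal (√Real.pi / 2) * ENNReal.ofReal (a n * (q : ℝ) ^ n) := by
        intro n
        rw [lintegral_mul_const _ (by fun_prop), ← lintegral_enorm_stdComplexGaussian, ← hζlaw n,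
          lintegral_map (by fun_prop) (hζmeas n)]
      simp_rw [hn]
      rw [ENNReal.tsum_mul_left]
      exact ENNReal.mul_ne_top (by simp) hs.tsum_ofReal_lt_top.ne
    filter_upwards [ae_lt_top (Measurable.tsum fun n => by fun_prop) hint] with ω hω
    refine (ENNReal.summable_toReal hω.ne).congr fun n => ?_
    rw [ENNReal.toReal_mul, toReal_enorm,
      ENNReal.toReal_ofReal (mul_nonneg (ha n) (pow_nonneg hq0 n)), norm_mul, Complex.norm_real,
      Real.norm_of_nonneg (ha n)]
    ring
  have hall : ∀ᵐ ω ∂P, ∀ q : ℚ, 0 ≤ (q : ℝ) → ENNReal.ofReal q < R →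
      Summable fun n => ‖(a n : ℂ) * ζ n ω‖ * (q : ℝ) ^ n := by
    rw [ae_all_iff]
    intro q
    by_cases h : 0 ≤ (q : ℝ) ∧ ENNReal.ofReal q < R
    · filter_upwards [hq q h.1 h.2] with ω hω _ _ using hω
    · exact Eventually.of_forall fun ω h1 h2 => absurd ⟨h1, h2⟩ h
  filter_upwards [hall] with ω hω r hr hrR
  obtain ⟨q, hq0, hrq, hqR⟩ := ENNReal.lt_iff_exists_rat_btwn.1 hrR
  have hq0' : 0 ≤ (q : ℝ) := by exact_mod_cast hq0
  have hrq' : r ≤ q := (ENNReal.ofReal_le_ofReal_iff hq0').1 hrq.le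
  refine Summable.of_nonneg_of_le (fun n => by positivity) (fun n => ?_) (hω q hq0' hqR)
  gcongr

/-! ### Moment and inverse estimates at a fixed point. -/

lemma norm_coeff_sq (a : ℕ → ℝ) (z : ℂ) (n : ℕ) :
    ‖(a n : ℂ) * z ^ n‖ ^ 2 = (a n * ‖z‖ ^ n) ^ 2 := by
  rw [norm_mul, norm_pow, Complex.norm_real, mul_pow, mul_pow, Real.norm_eq_abs, sq_abs]

lemma sum_term_eq (a : ℕ → ℝ) (z : ℂ) (w : ℕ → ℂ) (s : Finset ℕ) :
    ∑ n ∈ s, (a n : ℂ) * w n * z ^ n = ∑ n ∈ s, ((a n : ℂ) * z ^ n) * w n :=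
  Finset.sum_congr rfl fun n _ => by ring

/-- Fatou's lemma along the partial sums, whose moments are explicit. Only this upper bound is used
later. -/
lemma lintegral_norm_gaussianSeries_rpow_le [IsProbabilityMeasure P] {a : ℕ → ℝ}
    (ha : ∀ n, 0 ≤ a n) {R : ℝ≥0∞} (hR : R⁻¹ = rootLimsup a) (hζmeas : ∀ n, Measurable (ζ n))
    (hζindep : iIndepFun ζ P) (hζlaw : ∀ n, P.map (ζ n) = stdComplexGaussian)
    {p : ℝ} (hp : 0 < p) {z : ℂ} (hz : ‖z‖ₑ < R) :
    ∫⁻ ω, ENNReal.ofReal (‖gaussianSeries a (fun n => ζ n ω) z‖ ^ p) ∂P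
      ≤ ENNReal.ofReal (Real.Gamma (1 + p / 2)) * seriesVariance a ‖z‖ ^ (p / 2) := by
  set S : ℕ → Ω → ℂ := fun N ω => ∑ n ∈ Finset.range N, (a n : ℂ) * ζ n ω * z ^ n with hSdef
  have hSm : ∀ N, Measurable (S N) := fun N => by fun_prop
  have hG : 0 < Real.Gamma (1 + p / 2) := Real.Gamma_pos_of_pos (by positivity)
  calc _ ≤ ∫⁻ ω, liminf (fun N => ENNReal.ofReal (‖S N ω‖ ^ p)) atTop ∂P := by
        refine lintegral_mono_ae ?_
        filter_upwards [ae_convergesIn ha hR hζmeas hζlaw] with ω hω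
        have ht : Tendsto (fun N => S N ω) atTop (𝓝 (gaussianSeries a (fun n => ζ n ω) z)) :=
          (hω.summable hz).hasSum.tendsto_sum_nat
        have ht2 := ENNReal.tendsto_ofReal (ht.norm.rpow_const (p := p) (Or.inr hp.le))
        exact ht2.liminf_eq.ge
    _ ≤ liminf (fun N => ∫⁻ ω, ENNReal.ofReal (‖S N ω‖ ^ p) ∂P) atTop :=
        lintegral_liminf_le fun N => by fun_prop
    _ = _ := by
        have hN : ∀ N, ∫⁻ ω, ENNReal.ofReal (‖S N ω‖ ^ p) ∂P
            = ENNReal.ofReal (Real.Gamma (1 + p / 2)) *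
              ENNReal.ofReal (∑ n ∈ Finset.range N, (a n * ‖z‖ ^ n) ^ 2) ^ (p / 2) := by
          intro N
          simp_rw [hSdef, sum_term_eq]
          rw [lintegral_norm_sum_rpow hζmeas hζindep hζlaw _ _ hp, ENNReal.ofReal_mul hG.le,
            ENNReal.ofReal_rpow_of_nonneg (Finset.sum_nonneg fun i _ => sq_nonneg _)
              (by positivity)]
          simp_rw [norm_coeff_sq]
        simp_rw [hN]
        refine Tendsto.liminf_eq (ENNReal.Tendsto.const_mul ?_ (Or.inr (by simp)))
        exact (ENNReal.continuous_rpow_const.tendsto _).comp (tendsto_seriesVariance a ‖z‖)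

/-- Fatou's lemma again. Inversion is continuous on `ℝ≥0∞`, so the passage to the limit remains
valid where F(z) = 0. -/
lemma lintegral_enorm_zero_div_gaussianSeries_le [IsProbabilityMeasure P] {a : ℕ → ℝ}
    (ha : ∀ n, 0 ≤ a n) (ha0 : a 0 ≠ 0) {R : ℝ≥0∞} (hR : R⁻¹ = rootLimsup a)
    (hζmeas : ∀ n, Measurable (ζ n)) (hζindep : iIndepFun ζ P)
    (hζlaw : ∀ n, P.map (ζ n) = stdComplexGaussian) {z : ℂ} (hz : ‖z‖ₑ < R) :
    ∫⁻ ω, ‖gaussianSeries a (fun n => ζ n ω) 0‖ₑ * ‖gaussianSeries a (fun n => ζ n ω) z‖ₑ⁻¹ ∂P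
      ≤ ENNReal.ofReal (√Real.pi * a 0) * seriesVariance a ‖z‖ ^ (-(1 / 2) : ℝ) := by
  have ha0' : 0 < a 0 := lt_of_le_of_ne (ha 0) ha0.symm
  -- The shift to N + 1 ensures that every partial sum contains the term a_0 ζ_0, which is split off
  -- below.
  set S : ℕ → Ω → ℂ :=
    fun N ω => ∑ n ∈ Finset.range (N + 1), (a n : ℂ) * ζ n ω * z ^ n with hSdef
  have hSm : ∀ N, Measurable (S N) := fun N => by fun_prop
  simp_rw [gaussianSeries_zero]
  calc _ ≤ ∫⁻ ω, liminf (fun N => ‖(a 0 : ℂ) * ζ 0 ω‖ₑ * ‖S N ω‖ₑ⁻¹) atTop ∂P := by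
        refine lintegral_mono_ae ?_
        filter_upwards [ae_convergesIn ha hR hζmeas hζlaw] with ω hω
        have ht : Tendsto (fun N => S N ω) atTop (𝓝 (gaussianSeries a (fun n => ζ n ω) z)) :=
          (tendsto_add_atTop_iff_nat 1).2 (hω.summable hz).hasSum.tendsto_sum_nat
        have ht2 := ENNReal.Tendsto.const_mul (a := ‖(a 0 : ℂ) * ζ 0 ω‖ₑ)
          (tendsto_inv_iff.2 ht.enorm) (Or.inr enorm_ne_top)
        exact ht2.liminf_eq.ge
    _ ≤ liminf (fun N => ∫⁻ ω, ‖(a 0 : ℂ) * ζ 0 ω‖ₑ * ‖S N ω‖ₑ⁻¹ ∂P) atTop :=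
        lintegral_liminf_le fun N => by fun_prop
    _ ≤ liminf (fun N => ENNReal.ofReal (√Real.pi * a 0) *
          ENNReal.ofReal (∑ n ∈ Finset.range (N + 1), (a n * ‖z‖ ^ n) ^ 2) ^ (-(1 / 2) : ℝ))
          atTop := by
        refine liminf_le_liminf (Eventually.of_forall fun N => ?_)
        have h0 : 0 ∈ Finset.range (N + 1) := by simp
        set s := (Finset.range (N + 1)).erase 0 with hs
        have hsum : ∀ f : ℕ → ℂ, ∑ n ∈ Finset.range (N + 1), f n = f 0 + ∑ n ∈ s, f n :=
          fun f => (Finset.add_sum_erase _ f h0).symm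
        have hsumR : ∀ f : ℕ → ℝ, ∑ n ∈ Finset.range (N + 1), f n = f 0 + ∑ n ∈ s, f n :=
          fun f => (Finset.add_sum_erase _ f h0).symm
        have hS : ∀ ω, S N ω = (a 0 : ℂ) * ζ 0 ω + ∑ n ∈ s, ((a n : ℂ) * z ^ n) * ζ n ω := by
          intro ω
          simp_rw [hSdef]
          rw [hsum, sum_term_eq, pow_zero, mul_one]
        simp_rw [hS, hsumR, enorm_mul, mul_assoc]
        rw [lintegral_const_mul' _ _ (by simp)]
        have hmain := lintegral_enorm_div_sum_le hζmeas hζindep hζlaw ha0'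
          (fun n => (a n : ℂ) * z ^ n) (s := s) (by simp [hs])
        simp_rw [norm_coeff_sq] at hmain
        have hpos : 0 < a 0 ^ 2 + ∑ n ∈ s, (a n * ‖z‖ ^ n) ^ 2 :=
          add_pos_of_pos_of_nonneg (by positivity) (Finset.sum_nonneg fun i _ => sq_nonneg _)
        have hea : ‖(a 0 : ℂ)‖ₑ = ENNReal.ofReal (a 0) := by
          rw [← ofReal_norm, Complex.norm_real, Real.norm_of_nonneg (ha 0)]
        rw [hea, pow_zero, mul_one, ENNReal.ofReal_rpow_of_pos hpos,
          ← ENNReal.ofReal_mul (by positivity), Real.rpow_neg hpos.le, ← Real.sqrt_eq_rpow]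
        simp_rw [mul_assoc] at hmain
        refine (mul_le_mul' le_rfl hmain).trans_eq ?_
        rw [← ENNReal.ofReal_mul (ha 0)]
        congr 1
        ring
    _ = _ := by
        refine Tendsto.liminf_eq (ENNReal.Tendsto.const_mul ?_ (Or.inr ENNReal.ofReal_ne_top))
        exact (ENNReal.continuous_rpow_const.tendsto _).comp
          ((tendsto_add_atTop_iff_nat 1).2 (tendsto_seriesVariance a ‖z‖))

/-! ### Jensen and Hölder inequalities. -/

/-- Jensen's inequality between the geometric and the arithmetic mean. -/
lemma ofReal_exp_integral_log_le {α : Type*} [MeasurableSpace α] {ν : Measure α}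
    [IsProbabilityMeasure ν] {ψ : α → ℝ} (hψ : AEMeasurable ψ ν) (hpos : ∀ᵐ x ∂ν, 0 < ψ x)
    (hlog : Integrable (fun x => Real.log (ψ x)) ν) :
    ENNReal.ofReal (Real.exp (∫ x, Real.log (ψ x) ∂ν)) ≤ ∫⁻ x, ENNReal.ofReal (ψ x) ∂ν := by
  by_cases htop : ∫⁻ x, ENNReal.ofReal (ψ x) ∂ν = ⊤
  · rw [htop]; exact le_top
  have hpos' : 0 ≤ᵐ[ν] ψ := hpos.mono fun x hx => hx.le
  have hint : Integrable ψ ν := by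
    refine ⟨hψ.aestronglyMeasurable, ?_⟩
    rw [hasFiniteIntegral_iff_ofReal hpos']
    exact lt_top_iff_ne_top.2 htop
  have hexp : (fun x => Real.exp (Real.log (ψ x))) =ᵐ[ν] ψ :=
    hpos.mono fun x hx => Real.exp_log hx
  rw [← ofReal_integral_eq_lintegral_ofReal hint hpos', ← integral_congr_ae hexp]
  refine ENNReal.ofReal_le_ofReal ?_
  exact convexOn_exp.map_integral_le Real.continuous_exp.continuousOn isClosed_univ
    (by simp) hlog (hint.congr hexp.symm)

lemma isProbabilityMeasure_restrict_Ioc :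
    IsProbabilityMeasure (volume.restrict (Set.Ioc (0 : ℝ) 1)) :=
  ⟨by simp⟩

/-- The geometric mean of `|f|^p` over `[0, 1]`. -/
noncomputable def geomMean (p : ℝ) (f : ℝ → ℂ) : ℝ≥0∞ :=
  ENNReal.ofReal (Real.exp (∫ θ in (0 : ℝ)..1, Real.log (‖f θ‖ ^ p)))

lemma geomMean_ne_zero (p : ℝ) (f : ℝ → ℂ) : geomMean p f ≠ 0 := by
  rw [geomMean, ne_eq, ENNReal.ofReal_eq_zero, not_le]
  positivity

lemma geomMean_ne_top (p : ℝ) (f : ℝ → ℂ) : geomMean p f ≠ ⊤ := ENNReal.ofReal_ne_top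

/-- Nonvanishing is essential: since `Real.log 0 = 0`, zeros on a set of positive measure would
enter the geometric mean as the value 1. -/
lemma geomMean_le_lintegral {p : ℝ} (hp : 0 < p) {f : ℝ → ℂ} (hf : Measurable f)
    (hlog : IntervalIntegrable (fun θ => Real.log ‖f θ‖) volume 0 1)
    (hne : ∀ᵐ θ ∂volume.restrict (Set.Ioc (0 : ℝ) 1), f θ ≠ 0) :
    geomMean p f ≤ ∫⁻ θ in Set.Ioc (0 : ℝ) 1, ENNReal.ofReal (‖f θ‖ ^ p) := by
  have := isProbabilityMeasure_restrict_Ioc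
  rw [geomMean, intervalIntegral.integral_of_le zero_le_one]
  refine ofReal_exp_integral_log_le (hf.norm.pow_const p).aemeasurable
    (hne.mono fun θ hθ => Real.rpow_pos_of_pos (norm_pos_iff.2 hθ) p) ?_
  simp_rw [log_norm_rpow _ hp]
  exact ((intervalIntegrable_iff_integrableOn_Ioc_of_le zero_le_one).1 hlog).const_mul p

/-- Jensen applied to |f|⁻¹. No nonvanishing hypothesis is needed: zeros on a set of positive
measure make the right side infinite. -/
lemma geomMean_rpow_le_lintegral_inv {p : ℝ} (hp : 0 < p) {f : ℝ → ℂ} (hf : Measurable f)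
    (hlog : IntervalIntegrable (fun θ => Real.log ‖f θ‖) volume 0 1) :
    geomMean p f ^ (-(1 / p)) ≤ ∫⁻ θ in Set.Ioc (0 : ℝ) 1, ‖f θ‖ₑ⁻¹ := by
  have := isProbabilityMeasure_restrict_Ioc
  by_cases htop : ∫⁻ θ in Set.Ioc (0 : ℝ) 1, ‖f θ‖ₑ⁻¹ = ⊤
  · rw [htop]; exact le_top
  have hne : ∀ᵐ θ ∂volume.restrict (Set.Ioc (0 : ℝ) 1), f θ ≠ 0 := by
    filter_upwards [ae_lt_top hf.enorm.inv htop] with θ hθ h0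
    simp [h0] at hθ
  have hlog' := (intervalIntegrable_iff_integrableOn_Ioc_of_le zero_le_one).1 hlog
  have hJ := ofReal_exp_integral_log_le (ν := volume.restrict (Set.Ioc (0 : ℝ) 1))
    (ψ := fun θ => ‖f θ‖⁻¹) hf.norm.inv.aemeasurable
    (hne.mono fun θ hθ => inv_pos.2 (norm_pos_iff.2 hθ))
    (by simp_rw [Real.log_inv]; exact hlog'.neg)
  have hr : ∫⁻ θ in Set.Ioc (0 : ℝ) 1, ENNReal.ofReal ‖f θ‖⁻¹
      = ∫⁻ θ in Set.Ioc (0 : ℝ) 1, ‖f θ‖ₑ⁻¹ := by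
    refine lintegral_congr_ae ?_
    filter_upwards [hne] with θ hθ
    rw [ENNReal.ofReal_inv_of_pos (norm_pos_iff.2 hθ), ofReal_norm]
  rw [hr] at hJ
  refine le_trans (le_of_eq ?_) hJ
  rw [geomMean, ENNReal.ofReal_rpow_of_pos (Real.exp_pos _), ← Real.exp_mul,
    intervalIntegral.integral_of_le zero_le_one]
  simp_rw [log_norm_rpow _ hp, Real.log_inv]
  rw [integral_const_mul, integral_neg]
  congr 2
  field_simp

/-- Hölder with exponents 1 + p and (1 + p)/p for the factorisation κ^{p/2} = G^{1/(1+p)} · κ^{p/2}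
G^{-1/(1+p)}, raised to the power (1 + p)/p. The exponents are chosen so that G reappears to the
powers 1 and -1/p. -/
lemma lintegral_rpow_le_of_holder {α : Type*} [MeasurableSpace α] {ν : Measure α} {p : ℝ}
    (hp : 0 < p) {G κ : α → ℝ≥0∞} (hG : AEMeasurable G ν) (hκ : AEMeasurable κ ν)
    (hG0 : ∀ x, G x ≠ 0) (hGt : ∀ x, G x ≠ ⊤) :
    (∫⁻ x, κ x ^ (p / 2) ∂ν) ^ ((1 + p) / p) ≤
      (∫⁻ x, G x ∂ν) ^ (1 / p) * ∫⁻ x, κ x ^ ((1 + p) / 2) * G x ^ (-(1 / p)) ∂ν := by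
  have hp1 : 0 < 1 + p := by linarith
  have hpq : (1 + p).HolderConjugate ((1 + p) / p) := by
    rw [Real.holderConjugate_iff]
    refine ⟨by linarith, ?_⟩
    field_simp
  have h := ENNReal.lintegral_mul_le_Lp_mul_Lq ν hpq (f := fun x => G x ^ (1 / (1 + p)))
    (g := fun x => κ x ^ (p / 2) * G x ^ (-(1 / (1 + p)))) (hG.pow_const _)
    ((hκ.pow_const _).mul (hG.pow_const _))
  have h1 : ∀ x, ((fun x => G x ^ (1 / (1 + p))) *
      (fun x => κ x ^ (p / 2) * G x ^ (-(1 / (1 + p))))) x = κ x ^ (p / 2) := by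
    intro x
    simp only [Pi.mul_apply]
    rw [mul_left_comm, ← ENNReal.rpow_add _ _ (hG0 x) (hGt x), add_neg_cancel, ENNReal.rpow_zero,
      mul_one]
  have h2 : ∀ x, (G x ^ (1 / (1 + p))) ^ (1 + p) = G x := by
    intro x
    rw [← ENNReal.rpow_mul, one_div_mul_cancel hp1.ne', ENNReal.rpow_one]
  have h3 : ∀ x, (κ x ^ (p / 2) * G x ^ (-(1 / (1 + p)))) ^ ((1 + p) / p)
      = κ x ^ ((1 + p) / 2) * G x ^ (-(1 / p)) := by
    intro x
    rw [ENNReal.mul_rpow_of_nonneg _ _ (by positivity), ← ENNReal.rpow_mul, ← ENNReal.rpow_mul]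
    congr 2
    · field_simp
    · field_simp
  simp_rw [h1, h2, h3] at h
  have h4 := ENNReal.rpow_le_rpow h (z := (1 + p) / p) (by positivity)
  rw [ENNReal.mul_rpow_of_nonneg _ _ (by positivity), ← ENNReal.rpow_mul, ← ENNReal.rpow_mul,
    one_div_mul_cancel (by positivity), ENNReal.rpow_one] at h4
  refine h4.trans_eq ?_
  congr 2
  field_simp

lemma div_le_of_le_mul {x m Z W : ℝ≥0∞} (hZ0 : Z ≠ 0) (hZt : Z ≠ ⊤) (h : Z ≤ m * W) :
    x / m ≤ Z⁻¹ * (x * W) := by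
  rcases eq_or_ne m ⊤ with rfl | hmt
  · simp
  have hm0 : m ≠ 0 := by
    rintro rfl
    rw [zero_mul] at h
    exact hZ0 (le_antisymm h bot_le)
  calc x / m = x * m⁻¹ * (Z⁻¹ * Z) := by rw [ENNReal.inv_mul_cancel hZ0 hZt, mul_one]; rfl
    _ ≤ x * m⁻¹ * (Z⁻¹ * (m * W)) := by gcongr
    _ = Z⁻¹ * (x * W) * (m⁻¹ * m) := by ring
    _ = Z⁻¹ * (x * W) := by rw [ENNReal.inv_mul_cancel hm0 hmt, mul_one]

/-! ### The quantitative bound in terms of the variance. -/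

lemma measurable_gaussianSeries_polarPoint (a : ℕ → ℝ) :
    Measurable fun q : ((ℕ → ℂ) × ℝ) × ℝ => gaussianSeries a q.1.1 (polarPoint q.1.2 q.2) :=
  (measurable_gaussianSeries a).comp (measurable_fst.fst.prodMk
    (measurable_polarPoint.comp (measurable_fst.snd.prodMk measurable_snd)))

lemma measurable_geomMean (a : ℕ → ℝ) (p : ℝ) :
    Measurable fun q : (ℕ → ℂ) × ℝ =>
      geomMean p (fun θ => gaussianSeries a q.1 (polarPoint q.2 θ)) := by
  unfold geomMean
  simp_rw [intervalIntegral.integral_of_le zero_le_one]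
  have h := ((measurable_gaussianSeries_polarPoint a).norm.pow_const p).log.stronglyMeasurable
  have h1 := h.integral_prod_right' (ν := volume.restrict (Set.Ioc (0 : ℝ) 1))
  exact h1.measurable.exp.ennreal_ofReal

lemma measurable_geomMean_right (a : ℕ → ℝ) (p : ℝ) (w : ℕ → ℂ) :
    Measurable fun r => geomMean p (fun θ => gaussianSeries a w (polarPoint r θ)) := by
  have h : Measurable fun r : ℝ => (w, r) := measurable_prodMk_left
  have h2 := (measurable_geomMean a p).comp h
  exact h2

/-- Hölder and Jensen apply for almost every outcome, and Tonelli moves the expectation inside. The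
inverse estimate turns K^{(1+p)/2} into K^{p/2}, so the outer integral becomes Z, and Z^{-(1+p)/p} ·
Z = Z^{-1/p}. Finiteness of Z is what allows this last cancellation. -/
lemma lintegral_div_setLIntegral_geomMean_le [IsProbabilityMeasure P] {a : ℕ → ℝ}
    (ha : ∀ n, 0 ≤ a n) (ha0 : a 0 ≠ 0) {R : ℝ≥0∞} (hR : R⁻¹ = rootLimsup a)
    (hζmeas : ∀ n, Measurable (ζ n)) (hζindep : iIndepFun ζ P)
    (hζlaw : ∀ n, P.map (ζ n) = stdComplexGaussian) {μ : Measure ℝ} [IsFiniteMeasure μ]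
    {p : ℝ} (hp : 0 < p) {A : Set ℝ} (hA : MeasurableSet A) (hAR : A ⊆ radialInterval R)
    (hZ : ∫⁻ r in A, seriesVariance a r ^ (p / 2) ∂μ ≠ ⊤) :
    ∫⁻ ω, ‖gaussianSeries a (fun n => ζ n ω) 0‖ₑ / (∫⁻ r in A,
        geomMean p (fun θ => gaussianSeries a (fun n => ζ n ω) (polarPoint r θ)) ∂μ) ^ (1 / p) ∂P
      ≤ ENNReal.ofReal (√Real.pi * a 0) *
        (∫⁻ r in A, seriesVariance a r ^ (p / 2) ∂μ) ^ (-(1 / p)) := by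
  have ha0' : 0 < a 0 := lt_of_le_of_ne (ha 0) ha0.symm
  set Z := ∫⁻ r in A, seriesVariance a r ^ (p / 2) ∂μ with hZdef
  -- If Z = 0, the negative power makes the right side infinite.
  rcases eq_or_ne Z 0 with hZ0 | hZ0
  · rw [hZ0, ENNReal.zero_rpow_of_neg (by simpa using hp), ENNReal.mul_top]
    · exact le_top
    · rw [ne_eq, ENNReal.ofReal_eq_zero, not_le]; positivity
  have hK := measurable_seriesVariance a
  have hζm : Measurable fun ω n => ζ n ω := measurable_pi_lambda _ hζmeas
  have hFm : Measurable fun q : (Ω × ℝ) × ℝ =>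
      gaussianSeries a (fun n => ζ n q.1.1) (polarPoint q.1.2 q.2) :=
    (measurable_gaussianSeries_polarPoint a).comp
      (((hζm.comp measurable_fst.fst).prodMk measurable_fst.snd).prodMk measurable_snd)
  have hF0m : Measurable fun ω => gaussianSeries a (fun n => ζ n ω) 0 :=
    (measurable_gaussianSeries a).comp (hζm.prodMk measurable_const)
  let g : (Ω × ℝ) × ℝ → ℝ≥0∞ := fun q => ‖gaussianSeries a (fun n => ζ n q.1.1) 0‖ₑ *
    ‖gaussianSeries a (fun n => ζ n q.1.1) (polarPoint q.1.2 q.2)‖ₑ⁻¹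
  have hg : Measurable g := by
    refine Measurable.mul ?_ hFm.enorm.inv
    exact (hF0m.comp measurable_fst.fst).enorm
  have hgi : Measurable fun q : Ω × ℝ => ∫⁻ θ in Set.Ioc (0 : ℝ) 1, g (q, θ) :=
    hg.lintegral_prod_right'
  have hpt : ∀ᵐ ω ∂P, ‖gaussianSeries a (fun n => ζ n ω) 0‖ₑ / (∫⁻ r in A,
        geomMean p (fun θ => gaussianSeries a (fun n => ζ n ω) (polarPoint r θ)) ∂μ) ^ (1 / p)
      ≤ (Z ^ ((1 + p) / p))⁻¹ * ∫⁻ r in A, seriesVariance a r ^ ((1 + p) / 2) *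
        (∫⁻ θ in Set.Ioc (0 : ℝ) 1, g ((ω, r), θ)) ∂μ := by
    filter_upwards [ae_convergesIn ha hR hζmeas hζlaw] with ω hω
    have hGm : Measurable fun r =>
        geomMean p (fun θ => gaussianSeries a (fun n => ζ n ω) (polarPoint r θ)) :=
      measurable_geomMean_right a p _
    have hH := lintegral_rpow_le_of_holder (ν := μ.restrict A) hp hGm.aemeasurable hK.aemeasurable
      (fun _ => geomMean_ne_zero _ _) (fun _ => geomMean_ne_top _ _)
    rw [← hZdef] at hH
    refine (div_le_of_le_mul ?_ ?_ hH).trans ?_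
    · exact (ENNReal.rpow_pos (pos_iff_ne_zero.2 hZ0) hZ).ne'
    · exact ENNReal.rpow_ne_top_of_nonneg (by positivity) hZ
    · refine mul_le_mul' le_rfl ?_
      rw [← lintegral_const_mul' _ _ enorm_ne_top]
      refine setLIntegral_mono' hA fun r hr => ?_
      have hm : Measurable fun θ => gaussianSeries a (fun n => ζ n ω) (polarPoint r θ) :=
        hFm.comp (measurable_prodMk_left (x := (ω, r)))
      simp only [g]
      rw [mul_left_comm, lintegral_const_mul' _ _ enorm_ne_top]
      gcongr
      exact geomMean_rpow_le_lintegral_inv hp hm (hω.intervalIntegrable_log (hAR hr))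
  refine (lintegral_mono_ae hpt).trans ?_
  have hZp : (Z ^ ((1 + p) / p))⁻¹ ≠ ⊤ :=
    ENNReal.inv_ne_top.2 (ENNReal.rpow_pos (pos_iff_ne_zero.2 hZ0) hZ).ne'
  rw [lintegral_const_mul' _ _ hZp, lintegral_lintegral_swap
    (((hK.comp measurable_snd).pow_const _).mul hgi).aemeasurable]
  calc _ ≤ (Z ^ ((1 + p) / p))⁻¹ *
        ∫⁻ r in A, ENNReal.ofReal (√Real.pi * a 0) * seriesVariance a r ^ (p / 2) ∂μ := by
        refine mul_le_mul' le_rfl (setLIntegral_mono' hA fun r hr => ?_)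
        have hKt := (seriesVariance_lt_top ha hR (hAR hr).1.le (hAR hr).2).ne
        have hK0 := seriesVariance_ne_zero ha0 r
        have hsw : Measurable (Function.uncurry fun (ω : Ω) (θ : ℝ) => g ((ω, r), θ)) :=
          hg.comp ((measurable_fst.prodMk measurable_const).prodMk measurable_snd)
        rw [lintegral_const_mul' _ _ (ENNReal.rpow_ne_top_of_nonneg (by positivity) hKt),
          lintegral_lintegral_swap hsw.aemeasurable]
        calc _ ≤ seriesVariance a r ^ ((1 + p) / 2) * ∫⁻ _ in Set.Ioc (0 : ℝ) 1,
              ENNReal.ofReal (√Real.pi * a 0) * seriesVariance a r ^ (-(1 / 2) : ℝ) := by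
              refine mul_le_mul' le_rfl (lintegral_mono fun θ => ?_)
              have h := lintegral_enorm_zero_div_gaussianSeries_le ha ha0 hR hζmeas hζindep hζlaw
                (enorm_polarPoint_lt (hAR hr) θ)
              rwa [norm_polarPoint (hAR hr).1.le] at h
          _ = ENNReal.ofReal (√Real.pi * a 0) *
              (seriesVariance a r ^ ((1 + p) / 2) * seriesVariance a r ^ (-(1 / 2) : ℝ)) := by
              rw [setLIntegral_const, Real.volume_Ioc]
              simp
              ring
          _ = _ := by
              rw [← ENNReal.rpow_add _ _ hK0 hKt]
              congr 2
              ring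
    _ = _ := by
        rw [lintegral_const_mul' _ _ ENNReal.ofReal_ne_top, ← hZdef, ← ENNReal.rpow_neg,
          mul_left_comm]
        congr 1
        nth_rewrite 2 [← ENNReal.rpow_one Z]
        rw [← ENNReal.rpow_add _ _ hZ0 hZ]
        congr 1
        field_simp
        ring

/-- Removes the finiteness of Z, since Z = ∞ is the case that drives the equivalence. On the part of
the interval where K ≤ k the integral is finite because μ is. Shrinking the set only increases the
left side, and the right sides converge by monotone convergence as k → ∞. -/
lemma lintegral_div_geomMean_radialInterval_le [IsProbabilityMeasure P] {a : ℕ → ℝ}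
    (ha : ∀ n, 0 ≤ a n) (ha0 : a 0 ≠ 0) {R : ℝ≥0∞} (hR : R⁻¹ = rootLimsup a)
    (hζmeas : ∀ n, Measurable (ζ n)) (hζindep : iIndepFun ζ P)
    (hζlaw : ∀ n, P.map (ζ n) = stdComplexGaussian) {μ : Measure ℝ} [IsFiniteMeasure μ]
    {p : ℝ} (hp : 0 < p) {s : ℝ≥0∞} (hs : s ≤ R) :
    ∫⁻ ω, ‖gaussianSeries a (fun n => ζ n ω) 0‖ₑ / (∫⁻ r in radialInterval s,
        geomMean p (fun θ => gaussianSeries a (fun n => ζ n ω) (polarPoint r θ)) ∂μ) ^ (1 / p) ∂P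
      ≤ ENNReal.ofReal (√Real.pi * a 0) *
        (∫⁻ r in radialInterval s, seriesVariance a r ^ (p / 2) ∂μ) ^ (-(1 / p)) := by
  have hsR : radialInterval s ⊆ radialInterval R := fun r hr => ⟨hr.1, hr.2.trans_le hs⟩
  let A : ℕ → Set ℝ := fun k => radialInterval s ∩ {r | seriesVariance a r ≤ k}
  have hAm : ∀ k, MeasurableSet (A k) := fun k => (measurableSet_radialInterval s).inter
    (measurableSet_le (measurable_seriesVariance a) measurable_const)
  have hmono : Monotone A := fun k l hkl r hr =>
    by
    refine ⟨hr.1, ?_⟩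
    have h : seriesVariance a r ≤ k := hr.2
    exact h.trans (Nat.cast_le.2 hkl)
  have hU : ⋃ k, A k = radialInterval s := by
    refine Set.Subset.antisymm (Set.iUnion_subset fun k => Set.inter_subset_left) fun r hr => ?_
    obtain ⟨k, hk⟩ := ENNReal.exists_nat_gt
      (seriesVariance_lt_top ha hR (hsR hr).1.le (hsR hr).2).ne
    exact Set.mem_iUnion.2 ⟨k, hr, hk.le⟩
  have hlim : Tendsto (fun k => ∫⁻ r in A k, seriesVariance a r ^ (p / 2) ∂μ) atTop
      (𝓝 (∫⁻ r in radialInterval s, seriesVariance a r ^ (p / 2) ∂μ)) := by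
    rw [← hU, setLIntegral_iUnion_of_directed _ hmono.directed_le]
    exact tendsto_atTop_iSup fun k l hkl => lintegral_mono_set (hmono hkl)
  have hlim2 := ENNReal.Tendsto.const_mul (a := ENNReal.ofReal (√Real.pi * a 0))
    ((ENNReal.continuous_rpow_const (y := -(1 / p))).tendsto _ |>.comp hlim)
    (Or.inr ENNReal.ofReal_ne_top)
  refine ge_of_tendsto' hlim2 fun k => ?_
  have hfin : ∫⁻ r in A k, seriesVariance a r ^ (p / 2) ∂μ ≠ ⊤ := by
    have h : ∫⁻ r in A k, seriesVariance a r ^ (p / 2) ∂μ ≤ ∫⁻ _ in A k, (k : ℝ≥0∞) ^ (p / 2) ∂μ :=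
      setLIntegral_mono' (hAm k) fun r hr => ENNReal.rpow_le_rpow hr.2 (by positivity)
    rw [setLIntegral_const] at h
    refine (h.trans_lt (ENNReal.mul_lt_top ?_ (measure_lt_top μ _))).ne
    exact ENNReal.rpow_lt_top_of_nonneg (by positivity) (by simp)
  refine le_trans (lintegral_mono fun ω => ?_) (lintegral_div_setLIntegral_geomMean_le ha ha0 hR
    hζmeas hζindep hζlaw (μ := μ) hp (hAm k) (Set.inter_subset_left.trans hsR) hfin)
  exact ENNReal.div_le_div_left (ENNReal.rpow_le_rpow
    (lintegral_mono_set Set.inter_subset_left) (by positivity)) _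

/-! ### Almost sure nonvanishing and comparison with the Bergman norm. -/

lemma measurable_gaussianSeries_comp (a : ℕ → ℝ) (hζmeas : ∀ n, Measurable (ζ n)) :
    Measurable fun q : Ω × ℝ × ℝ =>
      gaussianSeries a (fun n => ζ n q.1) (polarPoint q.2.1 q.2.2) := by
  have hζm : Measurable fun ω n => ζ n ω := measurable_pi_lambda _ hζmeas
  exact (measurable_gaussianSeries_polarPoint a).comp
    (((hζm.comp measurable_fst).prodMk measurable_snd.fst).prodMk measurable_snd.snd)

lemma ae_gaussianSeries_zero_ne_zero {a : ℕ → ℝ} (ha0 : a 0 ≠ 0)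
    (hζmeas : ∀ n, Measurable (ζ n)) (hζlaw : ∀ n, P.map (ζ n) = stdComplexGaussian) :
    ∀ᵐ ω ∂P, gaussianSeries a (fun n => ζ n ω) 0 ≠ 0 := by
  have h : ∀ᵐ z ∂(P.map (ζ 0)), z ≠ 0 := by
    rw [hζlaw 0]; exact stdComplexGaussian_ae_ne_zero
  filter_upwards [ae_of_ae_map (hζmeas 0).aemeasurable h] with ω hω
  rw [gaussianSeries_zero]
  exact mul_ne_zero (by exact_mod_cast ha0) hω

/-- A consequence of the inverse estimate: |F(0)|/|F(z)| has finite expectation, yet it is infinite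
wherever F(z) = 0 and F(0) ≠ 0. -/
lemma ae_gaussianSeries_ne_zero [IsProbabilityMeasure P] {a : ℕ → ℝ}
    (ha : ∀ n, 0 ≤ a n) (ha0 : a 0 ≠ 0) {R : ℝ≥0∞} (hR : R⁻¹ = rootLimsup a)
    (hζmeas : ∀ n, Measurable (ζ n)) (hζindep : iIndepFun ζ P)
    (hζlaw : ∀ n, P.map (ζ n) = stdComplexGaussian) {z : ℂ} (hz : ‖z‖ₑ < R) :
    ∀ᵐ ω ∂P, gaussianSeries a (fun n => ζ n ω) z ≠ 0 := by
  have hζm : Measurable fun ω n => ζ n ω := measurable_pi_lambda _ hζmeas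
  have hFm : ∀ z, Measurable fun ω => gaussianSeries a (fun n => ζ n ω) z := fun z =>
    (measurable_gaussianSeries a).comp (hζm.prodMk measurable_const)
  have h := lintegral_enorm_zero_div_gaussianSeries_le ha ha0 hR hζmeas hζindep hζlaw hz
  have hfin : ENNReal.ofReal (√Real.pi * a 0) * seriesVariance a ‖z‖ ^ (-(1 / 2) : ℝ) < ⊤ := by
    refine ENNReal.mul_lt_top ENNReal.ofReal_lt_top (lt_top_iff_ne_top.2 ?_)
    rw [ENNReal.rpow_neg, ENNReal.inv_ne_top]
    have hz' : ENNReal.ofReal ‖z‖ < R := by rwa [ofReal_norm]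
    exact (ENNReal.rpow_pos (pos_iff_ne_zero.2 (seriesVariance_ne_zero ha0 _))
      (seriesVariance_lt_top ha hR (norm_nonneg z) hz').ne).ne'
  filter_upwards [ae_lt_top ((hFm 0).enorm.mul (hFm z).enorm.inv) (h.trans_lt hfin).ne,
    ae_gaussianSeries_zero_ne_zero ha0 hζmeas hζlaw] with ω hω h0 hz0
  rw [Pi.mul_apply, Pi.inv_apply, hz0, enorm_zero, ENNReal.inv_zero, ENNReal.mul_top (by simpa using h0)] at hω
  exact lt_irrefl _ hω

/-- Fubini exchanges "for each point, almost surely" with "almost surely, for almost every point",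
the form that Jensen's inequality on circles requires. -/
lemma ae_ae_ae_gaussianSeries_polarPoint_ne_zero [IsProbabilityMeasure P] {a : ℕ → ℝ}
    (ha : ∀ n, 0 ≤ a n) (ha0 : a 0 ≠ 0) {R : ℝ≥0∞} (hR : R⁻¹ = rootLimsup a)
    (hζmeas : ∀ n, Measurable (ζ n)) (hζindep : iIndepFun ζ P)
    (hζlaw : ∀ n, P.map (ζ n) = stdComplexGaussian) (μ : Measure ℝ) [IsFiniteMeasure μ] :
    ∀ᵐ ω ∂P, ∀ᵐ r ∂μ.restrict (radialInterval R), ∀ᵐ θ ∂volume.restrict (Set.Ioc (0 : ℝ) 1),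
      gaussianSeries a (fun n => ζ n ω) (polarPoint r θ) ≠ 0 := by
  have hq : ∀ᵐ q ∂(μ.restrict (radialInterval R)).prod (volume.restrict (Set.Ioc (0 : ℝ) 1)),
      ∀ᵐ ω ∂P, gaussianSeries a (fun n => ζ n ω) (polarPoint q.1 q.2) ≠ 0 := by
    filter_upwards [Measure.quasiMeasurePreserving_fst.ae
      (ae_restrict_mem (measurableSet_radialInterval R))] with q hq
    exact ae_gaussianSeries_ne_zero ha ha0 hR hζmeas hζindep hζlaw (enorm_polarPoint_lt hq _)
  have hm : MeasurableSet {q : Ω × ℝ × ℝ |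
      gaussianSeries a (fun n => ζ n q.1) (polarPoint q.2.1 q.2.2) ≠ 0} :=
    (measurable_gaussianSeries_comp a hζmeas) (measurableSet_singleton 0).compl
  filter_upwards [(Measure.ae_ae_comm hm).2 hq] with ω hω
  exact Measure.ae_ae_of_ae_prod hω

lemma measurable_geomMeanFunctional (a : ℕ → ℝ) (hζmeas : ∀ n, Measurable (ζ n))
    (μ : Measure ℝ) [IsFiniteMeasure μ] (p : ℝ) (s : ℝ≥0∞) :
    Measurable fun ω => geomMeanFunctional μ p s (gaussianSeries a fun n => ζ n ω) := by
  have hζm : Measurable fun ω n => ζ n ω := measurable_pi_lambda _ hζmeas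
  have h : Measurable fun q : Ω × ℝ =>
      geomMean p (fun θ => gaussianSeries a (fun n => ζ n q.1) (polarPoint q.2 θ)) := by
    have h0 : Measurable fun q : Ω × ℝ => ((fun n => ζ n q.1), q.2) :=
      (hζm.comp measurable_fst).prodMk measurable_snd
    have h1 := (measurable_geomMean a p).comp h0
    exact h1
  exact h.lintegral_prod_right'

lemma bergmanNorm_rpow (μ : Measure ℝ) {p : ℝ} (hp : 0 < p) (s : ℝ≥0∞) (f : ℂ → ℂ) :
    bergmanNorm μ p s f ^ p = ∫⁻ r in radialInterval s, (∫⁻ θ in Set.Ioc (0 : ℝ) 1,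
      ENNReal.ofReal (‖f (polarPoint r θ)‖ ^ p)) ∂μ := by
  rw [bergmanNorm, ← ENNReal.rpow_mul, one_div_mul_cancel hp.ne', ENNReal.rpow_one]

lemma lintegral_bergmanNorm_rpow_le [IsProbabilityMeasure P] {a : ℕ → ℝ}
    (ha : ∀ n, 0 ≤ a n) {R : ℝ≥0∞} (hR : R⁻¹ = rootLimsup a)
    (hζmeas : ∀ n, Measurable (ζ n)) (hζindep : iIndepFun ζ P)
    (hζlaw : ∀ n, P.map (ζ n) = stdComplexGaussian) (μ : Measure ℝ) [IsFiniteMeasure μ]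
    {p : ℝ} (hp : 0 < p) {s : ℝ≥0∞} (hs : s ≤ R) :
    ∫⁻ ω, bergmanNorm μ p s (gaussianSeries a fun n => ζ n ω) ^ p ∂P
      ≤ ENNReal.ofReal (Real.Gamma (1 + p / 2)) *
        ∫⁻ r in radialInterval s, seriesVariance a r ^ (p / 2) ∂μ := by
  have hF : Measurable fun q : Ω × ℝ × ℝ => ENNReal.ofReal
      (‖gaussianSeries a (fun n => ζ n q.1) (polarPoint q.2.1 q.2.2)‖ ^ p) :=
    ((measurable_gaussianSeries_comp a hζmeas).norm.pow_const p).ennreal_ofReal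
  have h1 : Measurable (Function.uncurry fun (ω : Ω) (r : ℝ) => ∫⁻ θ in Set.Ioc (0 : ℝ) 1,
      ENNReal.ofReal (‖gaussianSeries a (fun n => ζ n ω) (polarPoint r θ)‖ ^ p)) := by
    have h0 : Measurable fun q : (Ω × ℝ) × ℝ => (q.1.1, q.1.2, q.2) :=
      measurable_fst.fst.prodMk (measurable_fst.snd.prodMk measurable_snd)
    have h1 := (hF.comp h0).lintegral_prod_right' (ν := volume.restrict (Set.Ioc (0 : ℝ) 1))
    exact h1
  have h2 : ∀ r, Measurable (Function.uncurry fun (ω : Ω) (θ : ℝ) =>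
      ENNReal.ofReal (‖gaussianSeries a (fun n => ζ n ω) (polarPoint r θ)‖ ^ p)) := by
    intro r
    have h0 : Measurable fun q : Ω × ℝ => (q.1, r, q.2) :=
      measurable_fst.prodMk (measurable_const.prodMk measurable_snd)
    have h1 := hF.comp h0
    exact h1
  simp_rw [bergmanNorm_rpow μ hp]
  rw [lintegral_lintegral_swap h1.aemeasurable, ← lintegral_const_mul' _ _ ENNReal.ofReal_ne_top]
  refine setLIntegral_mono' (measurableSet_radialInterval s) fun r hr => ?_
  rw [lintegral_lintegral_swap (h2 r).aemeasurable]
  have hrR : r ∈ radialInterval R := ⟨hr.1, hr.2.trans_le hs⟩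
  calc _ ≤ ∫⁻ _ in Set.Ioc (0 : ℝ) 1,
        ENNReal.ofReal (Real.Gamma (1 + p / 2)) * seriesVariance a r ^ (p / 2) := by
        refine lintegral_mono fun θ => ?_
        have h := lintegral_norm_gaussianSeries_rpow_le ha hR hζmeas hζindep hζlaw hp
          (enorm_polarPoint_lt hrR θ)
        rwa [norm_polarPoint hr.1.le] at h
    _ = _ := by simp

lemma ae_geomMeanFunctional_le_bergmanNorm_rpow [IsProbabilityMeasure P] {a : ℕ → ℝ}
    (ha : ∀ n, 0 ≤ a n) (ha0 : a 0 ≠ 0) {R : ℝ≥0∞} (hR : R⁻¹ = rootLimsup a)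
    (hζmeas : ∀ n, Measurable (ζ n)) (hζindep : iIndepFun ζ P)
    (hζlaw : ∀ n, P.map (ζ n) = stdComplexGaussian) (μ : Measure ℝ) [IsFiniteMeasure μ]
    {p : ℝ} (hp : 0 < p) :
    ∀ᵐ ω ∂P, geomMeanFunctional μ p R (gaussianSeries a fun n => ζ n ω)
      ≤ bergmanNorm μ p R (gaussianSeries a fun n => ζ n ω) ^ p := by
  filter_upwards [ae_convergesIn ha hR hζmeas hζlaw,
    ae_ae_ae_gaussianSeries_polarPoint_ne_zero ha ha0 hR hζmeas hζindep hζlaw μ] with ω hω hne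
  rw [bergmanNorm_rpow μ hp]
  refine lintegral_mono_ae ?_
  filter_upwards [hne, ae_restrict_mem (measurableSet_radialInterval R)] with r hr hrR
  have hm : Measurable fun θ => gaussianSeries a (fun n => ζ n ω) (polarPoint r θ) :=
    (measurable_gaussianSeries_comp a hζmeas).comp
      (measurable_const.prodMk (measurable_const.prodMk measurable_id))
  exact geomMean_le_lintegral hp hm (hω.intervalIntegrable_log hrR) hr

/-- The moment bound E‖F‖^p ≤ Γ(1+p/2) Z is inserted into the denominator of the variance bound,
which is where the factor Γ(1+p/2)^{1/p} comes from. -/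
lemma lintegral_div_geomMeanFunctional_le [IsProbabilityMeasure P] {a : ℕ → ℝ}
    (ha : ∀ n, 0 ≤ a n) (ha0 : a 0 ≠ 0) {R : ℝ≥0∞} (hR : R⁻¹ = rootLimsup a)
    (hζmeas : ∀ n, Measurable (ζ n)) (hζindep : iIndepFun ζ P)
    (hζlaw : ∀ n, P.map (ζ n) = stdComplexGaussian) (μ : Measure ℝ) [IsFiniteMeasure μ]
    {p : ℝ} (hp : 0 < p) {s : ℝ≥0∞} (hs : s ≤ R) :
    ∫⁻ ω, ‖gaussianSeries a (fun n => ζ n ω) 0‖ₑ /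
        geomMeanFunctional μ p s (gaussianSeries a fun n => ζ n ω) ^ (1 / p) ∂P ≤
      ENNReal.ofReal (√Real.pi * Real.Gamma (1 + p / 2) ^ (1 / p) * a 0) /
        (∫⁻ ω, bergmanNorm μ p s (gaussianSeries a fun n => ζ n ω) ^ p ∂P) ^ (1 / p) := by
  have hG : 0 < Real.Gamma (1 + p / 2) := Real.Gamma_pos_of_pos (by positivity)
  have hGp : 0 < Real.Gamma (1 + p / 2) ^ (1 / p) := Real.rpow_pos_of_pos hG _
  refine (lintegral_div_geomMean_radialInterval_le ha ha0 hR hζmeas hζindep hζlaw (μ := μ) hp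
    hs).trans ?_
  have hE := ENNReal.rpow_le_rpow (lintegral_bergmanNorm_rpow_le ha hR hζmeas hζindep hζlaw μ hp
    hs) (z := 1 / p) (by positivity)
  rw [ENNReal.mul_rpow_of_nonneg _ _ (by positivity), ENNReal.ofReal_rpow_of_pos hG] at hE
  refine le_trans (le_of_eq ?_) (ENNReal.div_le_div_left hE _)
  rw [mul_right_comm, mul_comm, ENNReal.ofReal_mul' hGp.le, ENNReal.rpow_neg, mul_comm,
    mul_comm (ENNReal.ofReal (√Real.pi * a 0)) (ENNReal.ofReal _),
    ENNReal.mul_div_mul_left _ _ (by simpa using hGp) ENNReal.ofReal_ne_top]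
  exact (div_eq_mul_inv _ _).symm

end GaussianSeries

/-! ### The main theorem. -/

theorem theoremt {Ω : Type*} [MeasurableSpace Ω] (P : Measure Ω) [IsProbabilityMeasure P]
    (a : ℕ → ℝ) (ha : ∀ n, 0 ≤ a n) (ha0 : a 0 ≠ 0)
    (R : ℝ≥0∞) (hR : R⁻¹ = GaussianSeries.rootLimsup a)
    (hfin : GaussianSeries.rootLimsup a < ⊤)
    (ζ : ℕ → Ω → ℂ) (hζmeas : ∀ n, Measurable (ζ n)) (hζindep : iIndepFun ζ P)
    (hζlaw : ∀ n, P.map (ζ n) = GaussianSeries.stdComplexGaussian)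
    (F : Ω → ℂ → ℂ) (hF : ∀ ω z, F ω z = GaussianSeries.gaussianSeries a (fun n => ζ n ω) z)
    (μ : Measure ℝ) [IsFiniteMeasure μ] (hμpos : μ (Set.Iic 0) = 0)
    (hμR : GaussianSeries.outerRadius μ = R) (hμatom : μ {r : ℝ | ENNReal.ofReal r = R} = 0)
    (p : ℝ) (hp : 0 < p) :
    -- almost surely the series converges in the disc and the logarithmic means make sense
    (∀ᵐ ω ∂P,
      (∀ z : ℂ, ‖z‖ₑ < R → Summable fun n : ℕ => (a n : ℂ) * ζ n ω * z ^ n) ∧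
      ∀ r ∈ GaussianSeries.radialInterval R, IntervalIntegrable
        (fun θ => Real.log (‖F ω (GaussianSeries.polarPoint r θ)‖ ^ p)) volume 0 1) ∧
    -- the four equivalent conditions
    List.TFAE [
      ∀ᵐ ω ∂P, GaussianSeries.geomMeanFunctional μ p R (F ω) < ⊤,
      ∫⁻ ω, GaussianSeries.bergmanNorm μ p R (F ω) ^ p ∂P < ⊤,
      ∫⁻ ω, GaussianSeries.geomMeanFunctional μ p R (F ω) ∂P < ⊤,
      0 < P {ω | GaussianSeries.geomMeanFunctional μ p R (F ω) < ⊤}] ∧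
    -- the quantitative bound
    ∀ s : ℝ≥0∞, 0 < s → s ≤ R →
      ∫⁻ ω, ‖F ω 0‖ₑ / GaussianSeries.geomMeanFunctional μ p s (F ω) ^ (1 / p) ∂P ≤
        ENNReal.ofReal (√Real.pi * Real.Gamma (1 + p / 2) ^ (1 / p) * a 0) /
          (∫⁻ ω, GaussianSeries.bergmanNorm μ p s (F ω) ^ p ∂P) ^ (1 / p) := by
  obtain rfl : F = fun ω => GaussianSeries.gaussianSeries a fun n => ζ n ω := by
    ext ω z; exact hF ω z
  have hbound : ∀ s : ℝ≥0∞, s ≤ R → _ := fun s hs =>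
    GaussianSeries.lintegral_div_geomMeanFunctional_le ha ha0 hR hζmeas hζindep hζlaw μ hp hs
  have hMm := GaussianSeries.measurable_geomMeanFunctional a hζmeas μ p R
  refine ⟨?_, ?_, fun s _ hs => hbound s hs⟩
  · filter_upwards [GaussianSeries.ae_convergesIn ha hR hζmeas hζlaw] with ω hω
    refine ⟨fun z hz => hω.summable hz, fun r hr => ?_⟩
    simp_rw [GaussianSeries.log_norm_rpow _ hp]
    exact (hω.intervalIntegrable_log hr).const_mul p
  · tfae_have 1 → 4 := by
      intro h
      rw [measure_congr (eventuallyEq_univ.2 h), measure_univ]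
      exact zero_lt_one
    tfae_have 4 → 2 := by
      intro h
      -- An infinite expected norm makes the quantitative bound at s = R equal to 0. Then
      -- |F(0)|/M_R^{1/p} vanishes almost surely, and F(0) ≠ 0 leaves only M_R = ∞, against the
      -- positive probability.
      by_contra hE
      rw [not_lt, top_le_iff] at hE
      have hb := hbound R le_rfl
      rw [hE, ENNReal.top_rpow_of_pos (by positivity), ENNReal.div_top, nonpos_iff_eq_zero,
        lintegral_eq_zero_iff] at hb
      · refine h.ne' (measure_mono_null ?_ (ae_iff.1 (hb.and
          (GaussianSeries.ae_gaussianSeries_zero_ne_zero ha0 hζmeas hζlaw))))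
        rintro ω hω ⟨h1, h2⟩
        rw [Pi.zero_apply, ENNReal.div_eq_zero_iff] at h1
        rcases h1 with h1 | h1
        · exact h2 (enorm_eq_zero.1 h1)
        · exact ENNReal.rpow_ne_top_of_nonneg (by positivity) (ne_of_lt hω) h1
      · simp_rw [GaussianSeries.gaussianSeries_zero]
        exact ((hζmeas 0).const_mul _).enorm.div (hMm.pow_const _)
    tfae_have 2 → 3 := fun h => (lintegral_mono_ae
      (GaussianSeries.ae_geomMeanFunctional_le_bergmanNorm_rpow ha ha0 hR hζmeas hζindep hζlaw μ
        hp)).trans_lt h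
    tfae_have 3 → 1 := fun h => ae_lt_top hMm h.ne
    tfae_finish
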